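/- For every integer $t\ge 2$ there are a constant $c_t>0$ and an integer $n_0$ such that the following holds for all $n\ge n_0$. Let $A$ be a randomized single-pass streaming algorithm that reads the edges of a simple unweighted graph $G$ on $n$ vertices, each edge once and in an adversarially chosen order that does not depend on the algorithm's random bits, and let $s$ be the number of bits of memory it uses. Suppose that $A$ is a $(1+\frac1{2t})$-approximation algorithm for the maxcut value: for every such $G$ and every order of its edges, its output lies in the interval $$\Bigl[\mathrm{OPT}(G)\big/\bigl(1+\tfrac1{2t}\bigr),\ \mathrm{OPT}(G)\Bigr]$$ with probability at least $3/4$ over its internal randomness, where $\mathrm{OPT}(G)$ is the maximum, over all bipartitions of the vertex set, of the number of edges of $G$ crossing the bipartition. Then $s\ge c_t\,n^{1-1/t}$. In other words, $(1+\frac1{2t})$-approximating the maxcut value in the single-pass adversarial streaming model requires $\Omega(n^{1-1/t})$ space. The bound holds in the non-uniform model in which only the memory carried from one edge to the next is counted, while local computation, a random string and a counter of the edges read so far are free. -/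

import Mathlib

open MeasureTheory

namespace MaxCutStream

/-- The maxcut value of a graph: the maximum, over all bipartitions `(P, Pᶜ)` of the vertex set,
of the number of edges crossing the bipartition. As `P` and `Pᶜ` are disjoint, every crossing edge
is counted once, as the pair whose first entry lies in `P`. -/
noncomputable def maxCut {n : ℕ} (G : SimpleGraph (Fin n)) : ℕ := by
  classical
  exact Finset.univ.sup fun P : Finset (Fin n) => (G.interedges P Pᶜ).card

/-- A memory configuration of `s` bits. -/
abbrev Memory (s : ℕ) : Type := Fin s → Bool

/-- A randomized single-pass streaming algorithm for graphs on the vertex set `{0, …, n - 1}` that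
uses `s` bits of space, with internal randomness `ω` taken from `Ω`. The model is non-uniform and
generous to the algorithm: only the `s` bits carried from one stream item to the next
are charged. Local computation, access to `ω` and knowledge of the number of items read so far (the
argument of type `ℕ`) are free. Fresh coin tosses at each step are the special case in
which `ω` is a sequence of independent coins and step `i` only reads block `i` of it. -/
structure StreamAlg (n s : ℕ) (Ω : Type*) [MeasurableSpace Ω] where
  /-- the initial memory -/
  init : Ω → Memory s
  /-- the new memory after reading an edge, if `i` edges were read before it -/
  step : (i : ℕ) → Ω → Memory s → Sym2 (Fin n) → Memory s
  /-- the reported value, once the stream has ended after `i` edges -/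
  output : (i : ℕ) → Ω → Memory s → ℝ
  measurable_init : Measurable init
  measurable_step : ∀ i a e, Measurable fun ω => step i ω a e
  measurable_output : ∀ i a, Measurable fun ω => output i ω a

namespace StreamAlg

variable {n s : ℕ} {Ω : Type*} [MeasurableSpace Ω]

/-- The memory after processing the given items, in order, starting from memory `a` at a
moment when `i` items have already been read. -/
def runFrom (A : StreamAlg n s Ω) (ω : Ω) : ℕ → Memory s → List (Sym2 (Fin n)) → Memory s
  | _, a, [] => a
  | i, a, e :: l => A.runFrom ω (i + 1) (A.step i ω a e) l

/-- The value reported after a single pass over the stream `l`. -/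
def result (A : StreamAlg n s Ω) (ω : Ω) (l : List (Sym2 (Fin n))) : ℝ :=
  A.output l.length ω (A.runFrom ω 0 (A.init ω) l)

end StreamAlg

/-- `l` is an edge stream of `G`: it lists every edge of `G` exactly once, in some order. -/
def IsEdgeStream {n : ℕ} (G : SimpleGraph (Fin n)) (l : List (Sym2 (Fin n))) : Prop :=
  l.Nodup ∧ ∀ e, e ∈ l ↔ e ∈ G.edgeSet

/-- In the adversarial arrival model (with an oblivious adversary), `A` gives a `γ`-approximation
to maxcut with failure probability at most `δ`: for every input graph `G` and every order of its
edges, the output lies in `[OPT / γ, OPT]` with probability at least `1 - δ` over the internal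
randomness of the algorithm. -/
def StreamAlg.Approximates {n s : ℕ} {Ω : Type*} [MeasurableSpace Ω] (A : StreamAlg n s Ω)
    (μ : Measure Ω) (γ δ : ℝ) : Prop :=
  ∀ (G : SimpleGraph (Fin n)) (l : List (Sym2 (Fin n))), IsEdgeStream G l →
    1 - δ ≤ μ.real {ω | A.result ω l ∈ Set.Icc ((maxCut G : ℝ) / γ) (maxCut G : ℝ)}

end MaxCutStream

/-!
The proof is a reduction from a multipartite form of the Boolean hidden hypermatching problem. Its
inputs are a point `x` of the cube `{1, -1} ^ (κ × α)` with `|κ| = t` and `|α| = m`, and a uniformly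
random permutation `π k` of `α` for each `k`. The `j`-th hidden parity is the product of
the bits `x (k, π k j)` over `k`. The first player knows `x` and sends a message; the second player
knows the message, `π`, and a vector `w` that is either the vector of hidden parities or its
negative, and has to tell which.

*Graphs.* The hard graphs have levels that close up to a cycle of odd length `2 * t - 1`, where level
`0` consists of two hubs and each other level of `m` pairs of vertices. The edges from even levels
encode `x` and are read first, the edges from odd levels encode `π` and `w`. The edges split into
`2 * m` paths of length `2 * t - 1` from hub to hub. If `w` is opposite to the hidden parities, all of
them join different hubs, the graph is bipartite and its maxcut value is the number
`2 * m * (2 * t - 1)` of its edges (`exists_cut_all`). If `w` agrees with the hidden parities, all of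
them are closed walks of odd length and at least `2 * m` edges are not cut (`card_cut_le`). The ratio
of the two values exceeds `1 + 1 / (2 * t)`, so the output of the streaming algorithm separates the
cases, and the memory between the two parts of the stream is the message
(`lt_memory_of_approximates`).

*Communication bound.* For a fixed message let `A` be the set of inputs that produce it. Even
characters agree at `w` and `-w`, so the advantage of the second player is at most the `L²` norm of
the Fourier coefficients of `A` at the matched images of sets `s` with `|s| = l` odd
(`sq_advantage_le`). Averaging over `π`, each coefficient at a tuple of `l`-sets is weighted
by `1 / m.choose l ^ (t - 1)` (`sum_perm_odd_le`). The level inequality, which comes from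
hypercontractivity (`bonami_inequality`), bounds the Fourier weight of `A` on level `t * l`
(`level_inequality`), and on the reflected level by multiplication with the full character; `m` is
even, so the top level does not occur. With `S` bits of memory and `S` a small multiple of
`m ^ (1 - 1 / t)`, the resulting sum over `l` is below `1 / 4` and the advantage
is below `1 / 2` (`advantage_lt`), whereas success probability `3 / 4` on all inputs would give
advantage at least `1 / 2` for some outcome of the random bits.
-/

namespace MaxCutStream

/-! ### Fourier analysis and hypercontractivity on the discrete cube -/

section Fourier

variable {ι : Type*}

/-- The Walsh character `x ↦ ∏ i ∈ S, x i` of the discrete cube `{1, -1} ^ ι`, whose points are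
encoded as functions to the group `ℤˣ`. -/
def walsh (S : Finset ι) (x : ι → ℤˣ) : ℝ := ∏ i ∈ S, ((x i : ℤ) : ℝ)

lemma units_cast_mul_self (u : ℤˣ) : ((u : ℤ) : ℝ) * ((u : ℤ) : ℝ) = 1 := by
  rcases Int.units_eq_one_or u with rfl | rfl <;> norm_num

lemma walsh_mul_self (S : Finset ι) (x : ι → ℤˣ) : walsh S x * walsh S x = 1 := by
  rw [walsh, ← Finset.prod_mul_distrib]
  exact Finset.prod_eq_one fun i _ => units_cast_mul_self (x i)

lemma abs_walsh (S : Finset ι) (x : ι → ℤˣ) : |walsh S x| = 1 := by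
  have h := walsh_mul_self S x
  rw [← abs_mul_abs_self] at h
  nlinarith [abs_nonneg (walsh S x)]

lemma walsh_neg (S : Finset ι) (x : ι → ℤˣ) :
    walsh S (-x) = (-1) ^ S.card * walsh S x := by
  simp only [walsh, Pi.neg_apply, Units.val_neg, Int.cast_neg]
  rw [Finset.prod_neg]

lemma sum_walsh_mul_walsh [Fintype ι] (x y : ι → ℤˣ) :
    ∑ S : Finset ι, walsh S x * walsh S y = if x = y then 2 ^ Fintype.card ι else 0 := by
  have h : ∑ S : Finset ι, walsh S x * walsh S y
      = ∏ i : ι, (1 + ((x i : ℤ) : ℝ) * ((y i : ℤ) : ℝ)) := by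
    rw [Finset.prod_one_add, Finset.powerset_univ]
    exact Finset.sum_congr rfl fun S _ => (Finset.prod_mul_distrib).symm
  rw [h]
  split_ifs with hxy
  · subst hxy
    simp [units_cast_mul_self, one_add_one_eq_two]
  · obtain ⟨i, hi⟩ := Function.ne_iff.mp hxy
    refine Finset.prod_eq_zero (Finset.mem_univ i) ?_
    rcases Int.units_eq_one_or (x i) with hx | hx <;> rcases Int.units_eq_one_or (y i) with hy | hy
    all_goals simp_all

variable [DecidableEq ι]

lemma walsh_compl [Fintype ι] (S : Finset ι) (x : ι → ℤˣ) :
    walsh Sᶜ x = walsh Finset.univ x * walsh S x := by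
  have h : walsh Finset.univ x = walsh S x * walsh Sᶜ x :=
    (Finset.prod_mul_prod_compl S _).symm
  rw [h, mul_right_comm, walsh_mul_self, one_mul]

/-- Fourier inversion on the cube. -/
lemma sum_walsh_coeff [Fintype ι] (D : (ι → ℤˣ) → ℝ) (w : ι → ℤˣ) :
    ∑ S : Finset ι, (∑ y, D y * walsh S y) * walsh S w = 2 ^ Fintype.card ι * D w := by
  simp_rw [Finset.sum_mul]
  rw [Finset.sum_comm]
  have : ∀ y, ∑ S : Finset ι, D y * walsh S y * walsh S w
      = if y = w then D y * 2 ^ Fintype.card ι else 0 := fun y => by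
    simp_rw [mul_assoc]
    rw [← Finset.mul_sum, sum_walsh_mul_walsh, mul_ite, mul_zero]
  simp_rw [this]
  rw [Finset.sum_ite_eq' Finset.univ w]
  simp [mul_comm]

/-- Parseval's identity on the cube. -/
lemma sum_sq_walsh_coeff [Fintype ι] (D : (ι → ℤˣ) → ℝ) :
    ∑ S : Finset ι, (∑ y, D y * walsh S y) ^ 2 = 2 ^ Fintype.card ι * ∑ y, D y ^ 2 := by
  have h : ∀ S : Finset ι, (∑ y, D y * walsh S y) ^ 2
      = ∑ w, D w * ((∑ y, D y * walsh S y) * walsh S w) := fun S => by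
    rw [sq, Finset.mul_sum]
    exact Finset.sum_congr rfl fun w _ => by ring
  simp_rw [h]
  rw [Finset.sum_comm, Finset.mul_sum]
  refine Finset.sum_congr rfl fun w _ => ?_
  rw [← Finset.mul_sum, sum_walsh_coeff]
  ring

lemma choose_two_mul_le (q j : ℕ) (hq : 1 ≤ q) :
    ((2 * q).choose (2 * j) : ℝ) ≤ q.choose j * (2 * q - 1 : ℝ) ^ j := by
  have hq' : (1 : ℝ) ≤ q := by exact_mod_cast hq
  induction j with
  | zero => simp
  | succ j ih =>
    rcases Nat.lt_or_ge q (j + 1) with h | h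
    · rw [Nat.choose_eq_zero_of_lt (by omega : 2 * q < 2 * (j + 1))]
      simp only [Nat.cast_zero]
      exact mul_nonneg (Nat.cast_nonneg _) (pow_nonneg (by linarith) _)
    have hj : (j : ℝ) + 1 ≤ q := by exact_mod_cast h
    have e1 : ((2 * q).choose (2 * j + 1) : ℝ) * (2 * j + 1)
        = (2 * q).choose (2 * j) * (2 * q - 2 * j) := by
      have := Nat.choose_succ_right_eq (2 * q) (2 * j)
      have h2 : ((2 * q - 2 * j : ℕ) : ℝ) = 2 * q - 2 * j := by
        rw [Nat.cast_sub (by omega)]; push_cast; ring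
      rw [← h2]; exact_mod_cast this
    have e2 : ((2 * q).choose (2 * (j + 1)) : ℝ) * (2 * j + 2)
        = (2 * q).choose (2 * j + 1) * (2 * q - 2 * j - 1) := by
      have := Nat.choose_succ_right_eq (2 * q) (2 * j + 1)
      have h2 : ((2 * q - (2 * j + 1) : ℕ) : ℝ) = 2 * q - 2 * j - 1 := by
        rw [Nat.cast_sub (by omega)]; push_cast; ring
      rw [← h2]; exact_mod_cast this
    have e3 : (q.choose (j + 1) : ℝ) * (j + 1) = q.choose j * (q - j) := by
      have := Nat.choose_succ_right_eq q j
      have h2 : ((q - j : ℕ) : ℝ) = q - j := by rw [Nat.cast_sub (by omega)]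
      rw [← h2]; exact_mod_cast this
    have hpos : (0 : ℝ) < (2 * j + 1) * (j + 1) := by positivity
    have hjn : (0 : ℝ) ≤ j := Nat.cast_nonneg j
    have hP : (0 : ℝ) ≤ q.choose j * (2 * q - 1 : ℝ) ^ j :=
      mul_nonneg (Nat.cast_nonneg _) (pow_nonneg (by linarith) _)
    refine le_of_mul_le_mul_right ?_ hpos
    calc ((2 * q).choose (2 * (j + 1)) : ℝ) * ((2 * j + 1) * (j + 1))
        = (2 * q).choose (2 * j) * ((q - j) * (2 * q - 2 * j - 1)) := by
          linear_combination (2 * (j : ℝ) + 1) / 2 * e2 + (2 * q - 2 * j - 1 : ℝ) / 2 * e1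
      _ ≤ (q.choose j * (2 * q - 1 : ℝ) ^ j) * ((q - j) * (2 * q - 2 * j - 1)) := by
          refine mul_le_mul_of_nonneg_right ih (mul_nonneg ?_ ?_) <;> linarith
      _ ≤ (q.choose j * (2 * q - 1 : ℝ) ^ j) * ((q - j) * ((2 * q - 1) * (2 * j + 1))) := by
          refine mul_le_mul_of_nonneg_left (mul_le_mul_of_nonneg_left ?_ (by linarith)) hP
          nlinarith
      _ = q.choose (j + 1) * (2 * q - 1 : ℝ) ^ (j + 1) * ((2 * j + 1) * (j + 1)) := by
          rw [pow_succ]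
          linear_combination
            -(2 * q - 1 : ℝ) ^ j * (2 * q - 1) * (2 * j + 1) * e3

lemma add_pow_add_sub_pow (a b : ℝ) (q : ℕ) :
    (a + b) ^ (2 * q) + (a - b) ^ (2 * q)
      = 2 * ∑ j ∈ Finset.range (q + 1), (b ^ 2) ^ j * (a ^ 2) ^ (q - j) * (2 * q).choose (2 * j) := by
  have key : ∀ f : ℕ → ℝ, (∀ j, Odd j → f j = 0) → ∀ q : ℕ,
      ∑ j ∈ Finset.range (2 * q + 1), f j = ∑ j ∈ Finset.range (q + 1), f (2 * j) := by
    intro f hf q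
    induction q with
    | zero => simp
    | succ q ih =>
      rw [show 2 * (q + 1) + 1 = 2 * q + 1 + 1 + 1 by ring, Finset.sum_range_succ,
        Finset.sum_range_succ, ih, Finset.sum_range_succ _ (q + 1), hf (2 * q + 1) ⟨q, rfl⟩]
      simp [mul_add]
  rw [add_comm a b, sub_eq_neg_add, add_pow, add_pow, ← Finset.sum_add_distrib, key, Finset.mul_sum]
  · refine Finset.sum_congr rfl fun j hj => ?_
    have : j ≤ q := by simpa [Nat.lt_succ_iff] using hj
    rw [(even_two_mul j).neg_pow, ← Nat.mul_sub, pow_mul, pow_mul]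
    ring
  · intro j hj
    rw [hj.neg_pow]; ring

/-- The two-point hypercontractive inequality from `L²` to `L^(2q)`. -/
lemma two_point_inequality (a b : ℝ) (q : ℕ) (hq : 1 ≤ q) :
    (a + b) ^ (2 * q) + (a - b) ^ (2 * q) ≤ 2 * (a ^ 2 + (2 * q - 1) * b ^ 2) ^ q := by
  rw [add_pow_add_sub_pow, add_comm (a ^ 2), add_pow]
  refine mul_le_mul_of_nonneg_left (Finset.sum_le_sum fun j _ => ?_) zero_le_two
  have := mul_le_mul_of_nonneg_left (choose_two_mul_le q j hq)
    (by positivity : 0 ≤ (b ^ 2) ^ j * (a ^ 2) ^ (q - j))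
  calc _ ≤ _ := this
    _ = _ := by rw [mul_pow]; ring

/-- Minkowski's inequality for `q`-th moments, in a form free of roots. -/
lemma sum_add_pow_le {α : Type*} [Fintype α] (q : ℕ) (u v : α → ℝ) (hu : ∀ x, 0 ≤ u x)
    (hv : ∀ x, 0 ≤ v x) (K U V : ℝ) (hq : 1 ≤ q) (hU : 0 ≤ U) (hV : 0 ≤ V)
    (h1 : ∑ x, u x ^ q ≤ K * U ^ q) (h2 : ∑ x, v x ^ q ≤ K * V ^ q) :
    ∑ x, (u x + v x) ^ q ≤ K * (U + V) ^ q := by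
  have zero_of : ∀ w : α → ℝ, (∀ x, 0 ≤ w x) → ∑ x, w x ^ q ≤ K * 0 ^ q → ∀ x, w x = 0 := by
    intro w hw h x
    rw [zero_pow (by omega), mul_zero] at h
    have := (Finset.sum_eq_zero_iff_of_nonneg (fun x _ => pow_nonneg (hw x) q)).mp
      (le_antisymm h (Finset.sum_nonneg fun x _ => pow_nonneg (hw x) q)) x (Finset.mem_univ x)
    exact pow_eq_zero_iff (by omega) |>.mp this
  rcases hU.eq_or_lt with rfl | hU
  · simpa [zero_of u hu h1] using h2
  rcases hV.eq_or_lt with rfl | hV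
  · simpa [zero_of v hv h2] using h1
  have hUV : 0 < U + V := add_pos hU hV
  -- convexity of `y ↦ y ^ q` at `u / U` and `v / V` with weights `U / (U + V)` and `V / (U + V)`
  have conv : ∀ x, (u x + v x) ^ q
      ≤ (U + V) ^ q * (U / (U + V) * (u x ^ q / U ^ q) + V / (U + V) * (v x ^ q / V ^ q)) := by
    intro x
    have := (convexOn_pow q).2 (div_nonneg (hu x) hU.le) (div_nonneg (hv x) hV.le)
      (div_pos hU hUV).le (div_pos hV hUV).le (by field_simp)
    simp only [smul_eq_mul, div_pow] at this
    refine le_trans (le_of_eq ?_) (mul_le_mul_of_nonneg_left this (pow_nonneg hUV.le q))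
    rw [← mul_pow]
    congr 1
    field_simp
  refine (Finset.sum_le_sum fun x _ => conv x).trans ?_
  rw [← Finset.mul_sum, Finset.sum_add_distrib, ← Finset.mul_sum, ← Finset.mul_sum,
    ← Finset.sum_div, ← Finset.sum_div, mul_comm K]
  refine mul_le_mul_of_nonneg_left ?_ (pow_nonneg hUV.le q)
  have b1 : (∑ x, u x ^ q) / U ^ q ≤ K := (div_le_iff₀ (pow_pos hU q)).mpr h1
  have b2 : (∑ x, v x ^ q) / V ^ q ≤ K := (div_le_iff₀ (pow_pos hV q)).mpr h2
  calc _ ≤ U / (U + V) * K + V / (U + V) * K :=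
        add_le_add (mul_le_mul_of_nonneg_left b1 (div_pos hU hUV).le)
          (mul_le_mul_of_nonneg_left b2 (div_pos hV hUV).le)
    _ = K := by field_simp

/-- The Bonami inequality: hypercontractivity from `L²` to `L^(2q)` on the discrete cube, with
the Fourier weights made explicit. -/
theorem bonami_inequality [Fintype ι] (q : ℕ) (hq : 1 ≤ q) (T : Finset ι) (a : Finset ι → ℝ) :
    ∑ x : ι → ℤˣ, (∑ S ∈ T.powerset, a S * walsh S x) ^ (2 * q)
      ≤ Fintype.card (ι → ℤˣ) * (∑ S ∈ T.powerset, (2 * q - 1 : ℝ) ^ S.card * a S ^ 2) ^ q := by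
  have hq' : (0 : ℝ) ≤ 2 * q - 1 := by
    have : (1 : ℝ) ≤ q := by exact_mod_cast hq
    linarith
  induction T using Finset.induction_on generalizing a with
  | empty => simp [walsh, pow_mul]
  | insert i T hi ih =>
    set g₀ : (ι → ℤˣ) → ℝ := fun x => ∑ S ∈ T.powerset, a S * walsh S x with hg₀
    set g₁ : (ι → ℤˣ) → ℝ := fun x => ∑ S ∈ T.powerset, a (insert i S) * walsh S x with hg₁
    have hnot : ∀ S ∈ T.powerset, i ∉ S := fun S hS h => hi (Finset.mem_powerset.mp hS h)
    have hsplit : ∀ f : Finset ι → ℝ, ∑ S ∈ (insert i T).powerset, f S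
        = ∑ S ∈ T.powerset, f S + ∑ S ∈ T.powerset, f (insert i S) := by
      intro f
      rw [Finset.sum_powerset_insert hi]
    have hg : ∀ x, ∑ S ∈ (insert i T).powerset, a S * walsh S x
        = g₀ x + ((x i : ℤ) : ℝ) * g₁ x := by
      intro x
      rw [hsplit, hg₀, hg₁, Finset.mul_sum]
      congr 1
      refine Finset.sum_congr rfl fun S hS => ?_
      rw [walsh, Finset.prod_insert (hnot S hS), ← walsh]
      ring
    let flip : (ι → ℤˣ) → (ι → ℤˣ) := fun x => Function.update x i (-x i)
    have hflip : Function.Involutive flip := fun x => by simp [flip]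
    have hwalsh : ∀ S ∈ T.powerset, ∀ x, walsh S (flip x) = walsh S x := fun S hS x =>
      Finset.prod_congr rfl fun j hj => by
        have hji : j ≠ i := by
          rintro rfl
          exact hnot S hS hj
        rw [show flip x j = x j from Function.update_of_ne hji _ _]
    have hf₀ : ∀ x, g₀ (flip x) = g₀ x := fun x =>
      Finset.sum_congr rfl fun S hS => by rw [hwalsh S hS]
    have hf₁ : ∀ x, g₁ (flip x) = g₁ x := fun x =>
      Finset.sum_congr rfl fun S hS => by rw [hwalsh S hS]
    have hsym : ∑ x, (g₀ x + ((x i : ℤ) : ℝ) * g₁ x) ^ (2 * q)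
        = ∑ x, (g₀ x - ((x i : ℤ) : ℝ) * g₁ x) ^ (2 * q) := by
      rw [← Equiv.sum_comp hflip.toPerm]
      refine Finset.sum_congr rfl fun x _ => ?_
      rw [Function.Involutive.coe_toPerm, hf₀, hf₁]
      simp [flip, sub_eq_add_neg]
    simp_rw [hg]
    have hpt : ∀ x, (g₀ x + ((x i : ℤ) : ℝ) * g₁ x) ^ (2 * q)
        + (g₀ x - ((x i : ℤ) : ℝ) * g₁ x) ^ (2 * q)
        ≤ 2 * (g₀ x ^ 2 + (2 * q - 1) * g₁ x ^ 2) ^ q := fun x => by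
      have := two_point_inequality (g₀ x) (((x i : ℤ) : ℝ) * g₁ x) q hq
      rwa [mul_pow, sq ((x i : ℤ) : ℝ), units_cast_mul_self, one_mul] at this
    have hstep : ∑ x, (g₀ x + ((x i : ℤ) : ℝ) * g₁ x) ^ (2 * q)
        ≤ ∑ x, (g₀ x ^ 2 + (2 * q - 1) * g₁ x ^ 2) ^ q := by
      have := Finset.sum_le_sum fun x (_ : x ∈ (Finset.univ : Finset (ι → ℤˣ))) => hpt x
      rw [Finset.sum_add_distrib, ← hsym, ← Finset.mul_sum] at this
      linarith
    refine hstep.trans ?_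
    rw [hsplit]
    refine sum_add_pow_le q _ _ (fun x => sq_nonneg _) (fun x => mul_nonneg hq' (sq_nonneg _))
      _ _ _ hq (Finset.sum_nonneg fun S _ => mul_nonneg (pow_nonneg hq' _) (sq_nonneg _))
      (Finset.sum_nonneg fun S _ => mul_nonneg (pow_nonneg hq' _) (sq_nonneg _)) ?_ ?_
    · simp_rw [← pow_mul]
      exact ih a
    · simp_rw [mul_pow, ← pow_mul]
      rw [← Finset.mul_sum]
      refine (mul_le_mul_of_nonneg_left (ih fun S => a (insert i S)) (pow_nonneg hq' q)).trans
        (le_of_eq ?_)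
      rw [mul_left_comm, ← mul_pow, Finset.mul_sum]
      congr 2
      refine Finset.sum_congr rfl fun S hS => ?_
      rw [Finset.card_insert_of_notMem (hnot S hS), pow_succ]
      ring

/-- The unnormalized Fourier coefficient at `S` of the indicator function of `A`. -/
def fourierCount (A : Finset (ι → ℤˣ)) (S : Finset ι) : ℝ := ∑ x ∈ A, walsh S x

/-- The level inequality for a function supported on `A` with values in `[-1, 1]`: its Fourier
weight on level `k` is far below Parseval's bound when `A` is large and `k` is small. The exponent
`q` is a free parameter, to be chosen in terms of `k`. -/
lemma level_inequality_of_bounded [Fintype ι] (A : Finset (ι → ℤˣ)) (f : (ι → ℤˣ) → ℝ)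
    (hf : ∀ x, |f x| ≤ 1) (k q : ℕ) (hq : 1 ≤ q) :
    (∑ S ∈ Finset.powersetCard k Finset.univ, (∑ x ∈ A, f x * walsh S x) ^ 2) ^ q
      ≤ (A.card : ℝ) ^ (2 * q - 1) * Fintype.card (ι → ℤˣ) * ((2 * q - 1 : ℝ) ^ k) ^ q := by
  set F : Finset ι → ℝ := fun S => ∑ x ∈ A, f x * walsh S x with hF
  set W := ∑ S ∈ Finset.powersetCard k Finset.univ, F S ^ 2 with hW
  set g : (ι → ℤˣ) → ℝ := fun x => ∑ S ∈ Finset.powersetCard k Finset.univ, F S * walsh S x with hg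
  have hq' : (0 : ℝ) ≤ 2 * q - 1 := by
    have : (1 : ℝ) ≤ q := by exact_mod_cast hq
    linarith
  have hW0 : 0 ≤ W := Finset.sum_nonneg fun S _ => sq_nonneg _
  have hpair : W = ∑ x ∈ A, f x * g x := by
    simp_rw [hW, hg, Finset.mul_sum]
    rw [Finset.sum_comm]
    refine Finset.sum_congr rfl fun S _ => ?_
    rw [sq]
    nth_rewrite 2 [hF]
    rw [Finset.mul_sum]
    exact Finset.sum_congr rfl fun x _ => by ring
  have hbon : ∑ x, g x ^ (2 * q) ≤ Fintype.card (ι → ℤˣ) * ((2 * q - 1 : ℝ) ^ k * W) ^ q := by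
    have := bonami_inequality q hq Finset.univ fun S => if S.card = k then F S else 0
    simp only [ite_mul, zero_mul, ite_pow, mul_ite, mul_zero, ne_eq, OfNat.ofNat_ne_zero,
      not_false_eq_true, zero_pow] at this
    simp only [← Finset.sum_filter, ← Finset.powersetCard_eq_filter] at this
    refine this.trans (le_of_eq ?_)
    congr 2
    rw [hW, Finset.mul_sum]
    refine Finset.sum_congr rfl fun S hS => ?_
    rw [(Finset.mem_powersetCard.mp hS).2]
  have hle : W ≤ ∑ x ∈ A, |g x| := by
    rw [hpair]
    refine Finset.sum_le_sum fun x _ => (le_abs_self _).trans ?_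
    rw [abs_mul]
    exact mul_le_of_le_one_left (abs_nonneg _) (hf x)
  have hmom : W ^ (2 * q) ≤ (A.card : ℝ) ^ (2 * q - 1) * ∑ x, g x ^ (2 * q) := by
    obtain ⟨p, hp⟩ : ∃ p, 2 * q = p + 1 := ⟨2 * q - 1, by omega⟩
    have h1 : ∑ x ∈ A, |g x| ^ (2 * q) ≤ ∑ x, g x ^ (2 * q) := by
      simp_rw [pow_mul, sq_abs]
      exact Finset.sum_le_sum_of_subset_of_nonneg (Finset.subset_univ A)
        fun x _ _ => pow_nonneg (sq_nonneg _) q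
    have h2 := pow_sum_div_card_le_sum_pow (s := A) (f := fun x => |g x|)
      (fun x _ => abs_nonneg _) p
    rcases A.eq_empty_or_nonempty with rfl | hA
    · have : W = 0 := by rw [hpair]; simp
      rw [this, zero_pow (by omega)]
      exact mul_nonneg (by positivity) (Finset.sum_nonneg fun x _ => by
        rw [pow_mul]; exact pow_nonneg (sq_nonneg _) q)
    · have hA' : (0 : ℝ) < A.card := by exact_mod_cast hA.card_pos
      rw [div_le_iff₀ (pow_pos hA' p)] at h2
      rw [show 2 * q - 1 = p by omega]
      calc W ^ (2 * q) ≤ (∑ x ∈ A, |g x|) ^ (2 * q) := pow_le_pow_left₀ hW0 hle _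
        _ ≤ (∑ x ∈ A, |g x| ^ (2 * q)) * (A.card : ℝ) ^ p := by rw [hp]; exact h2
        _ ≤ _ := by
          rw [mul_comm]
          exact mul_le_mul_of_nonneg_left h1 (by positivity)
  rcases hW0.eq_or_lt with h0 | hpos
  · rw [← h0, zero_pow (by omega)]
    positivity
  · refine le_of_mul_le_mul_right ?_ (pow_pos hpos q)
    calc W ^ q * W ^ q = W ^ (2 * q) := by rw [← pow_add, two_mul]
      _ ≤ (A.card : ℝ) ^ (2 * q - 1)
          * (Fintype.card (ι → ℤˣ) * ((2 * q - 1 : ℝ) ^ k * W) ^ q) :=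
        hmom.trans (mul_le_mul_of_nonneg_left hbon (by positivity))
      _ = _ := by rw [mul_pow]; ring

lemma level_inequality [Fintype ι] (A : Finset (ι → ℤˣ)) (k q : ℕ) (hq : 1 ≤ q) :
    (∑ S ∈ Finset.powersetCard k Finset.univ, fourierCount A S ^ 2) ^ q
      ≤ (A.card : ℝ) ^ (2 * q - 1) * Fintype.card (ι → ℤˣ) * ((2 * q - 1 : ℝ) ^ k) ^ q := by
  simpa [fourierCount] using level_inequality_of_bounded A (fun _ => 1) (by simp) k q hq

/-- Multiplication by the full character `walsh univ` exchanges levels `k` and `|ι| - k`, so that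
the level inequality holds near the top as well. -/
lemma level_inequality_compl [Fintype ι] (A : Finset (ι → ℤˣ)) (k q : ℕ) (hq : 1 ≤ q)
    (hk : k ≤ Fintype.card ι) :
    (∑ S ∈ Finset.powersetCard (Fintype.card ι - k) Finset.univ, fourierCount A S ^ 2) ^ q
      ≤ (A.card : ℝ) ^ (2 * q - 1) * Fintype.card (ι → ℤˣ) * ((2 * q - 1 : ℝ) ^ k) ^ q := by
  refine le_trans (le_of_eq ?_) (level_inequality_of_bounded A (walsh Finset.univ)
    (fun x => (abs_walsh _ x).le) k q hq)
  congr 1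
  refine Finset.sum_nbij' compl compl ?_ ?_ (fun S _ => compl_compl S) (fun S _ => compl_compl S) ?_
  · intro S hS
    have := (Finset.mem_powersetCard.mp hS).2
    simp [Finset.card_compl, this]
    omega
  · intro S hS
    have := (Finset.mem_powersetCard.mp hS).2
    simp [Finset.card_compl, this]
  · intro S _
    rw [fourierCount]
    congr 1
    refine Finset.sum_congr rfl fun x _ => ?_
    rw [walsh_compl, ← mul_assoc, walsh_mul_self, one_mul]

end Fourier

/-! ### Hidden parities under random permutations -/

section Matching

variable {κ α : Type*} [Fintype κ] [Fintype α] [DecidableEq α]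

lemma exists_perm_map_eq {J T : Finset α} (h : J.card = T.card) :
    ∃ σ : Equiv.Perm α, J.map σ.toEmbedding = T := by
  let e : {x // x ∈ J} ≃ {x // x ∈ T} := Finset.equivOfCardEq h
  refine ⟨e.extendSubtype, Finset.eq_of_subset_of_card_le ?_ (by rw [Finset.card_map, h])⟩
  intro y hy
  obtain ⟨x, hx, rfl⟩ := Finset.mem_map.mp hy
  exact e.extendSubtype_mem x hx

/-- The disjoint union of a family of finite sets, as a set of pairs. -/
def tupleSet (T : κ → Finset α) : Finset (κ × α) := Finset.univ.filter fun p => p.2 ∈ T p.1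

lemma mem_tupleSet (T : κ → Finset α) (p : κ × α) : p ∈ tupleSet T ↔ p.2 ∈ T p.1 := by
  simp [tupleSet]

lemma card_tupleSet (T : κ → Finset α) : (tupleSet T).card = ∑ k, (T k).card := by
  have h := Finset.sum_finset_product (tupleSet T) Finset.univ T
    (fun p => by simp [mem_tupleSet]) (f := fun _ => 1)
  simpa using h

lemma tupleSet_injective : Function.Injective (tupleSet : (κ → Finset α) → Finset (κ × α)) := by
  intro T T' h
  funext k
  ext i
  rw [← mem_tupleSet T (k, i), ← mem_tupleSet T' (k, i), h]

/-- The hidden parities. The permutations `π k` cut the coordinates `κ × α` into the hyperedges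
`{(k, π k j) : k ∈ κ}`, one for each `j`, and the `j`-th parity is the product of the bits of `x`
in the `j`-th hyperedge. -/
def hiddenParity (π : κ → Equiv.Perm α) (x : κ × α → ℤˣ) (j : α) : ℤˣ := ∏ k, x (k, π k j)

lemma walsh_hiddenParity (π : κ → Equiv.Perm α) (x : κ × α → ℤˣ) (s : Finset α) :
    walsh s (hiddenParity π x) = walsh (tupleSet fun k => s.map (π k).toEmbedding) x := by
  rw [walsh, walsh, Finset.prod_finset_product (tupleSet fun k => s.map (π k).toEmbedding)
    Finset.univ (fun k => s.map (π k).toEmbedding) (fun p => by simp [mem_tupleSet])]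
  simp only [hiddenParity, Units.coe_prod, Int.cast_prod, Finset.prod_map]
  rw [Finset.prod_comm]
  rfl

/-- A decision rule `D`, with values `± 1 / 2`, that sees the parities or their negatives only
through the knowledge that `x ∈ A` has an advantage controlled by the odd part of the Fourier
transform of `A`: even characters take the same value at `w` and at `-w`. -/
lemma sq_advantage_le (A : Finset (κ × α → ℤˣ)) (π : κ → Equiv.Perm α) (D : (α → ℤˣ) → ℝ)
    (hD : ∀ w, D w ^ 2 = 1 / 4) :
    (∑ x ∈ A, (D (-hiddenParity π x) - D (hiddenParity π x))) ^ 2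
      ≤ ∑ s : Finset α with Odd s.card,
        fourierCount A (tupleSet fun k => s.map (π k).toEmbedding) ^ 2 := by
  set N : ℝ := 2 ^ Fintype.card α with hN
  have hNpos : 0 < N := by positivity
  set c : Finset α → ℝ := fun s => ∑ y, D y * walsh s y with hc
  set F : Finset α → ℝ := fun s =>
    fourierCount A (tupleSet fun k => s.map (π k).toEmbedding) with hF
  have hpt : ∀ x, N * (D (-hiddenParity π x) - D (hiddenParity π x))
      = ∑ s : Finset α with Odd s.card, (-2 * c s) * walsh s (hiddenParity π x) := by
    intro x
    rw [mul_sub, ← sum_walsh_coeff, ← sum_walsh_coeff, ← Finset.sum_sub_distrib,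
      Finset.sum_filter]
    refine Finset.sum_congr rfl fun s _ => ?_
    rw [walsh_neg]
    split_ifs with h
    · rw [h.neg_one_pow]; ring
    · rw [(Nat.not_odd_iff_even.mp h).neg_one_pow]; ring
  have hsum : N * ∑ x ∈ A, (D (-hiddenParity π x) - D (hiddenParity π x))
      = ∑ s : Finset α with Odd s.card, (-2 * c s) * F s := by
    rw [Finset.mul_sum, Finset.sum_congr rfl fun x _ => hpt x, Finset.sum_comm]
    refine Finset.sum_congr rfl fun s _ => ?_
    rw [← Finset.mul_sum]
    simp_rw [walsh_hiddenParity]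
    rfl
  have hpars : ∑ s : Finset α with Odd s.card, (-2 * c s) ^ 2 ≤ N ^ 2 := by
    calc ∑ s : Finset α with Odd s.card, (-2 * c s) ^ 2 ≤ ∑ s, (-2 * c s) ^ 2 :=
          Finset.sum_le_sum_of_subset_of_nonneg (Finset.filter_subset _ _)
            fun _ _ _ => sq_nonneg _
      _ = 4 * ∑ s, c s ^ 2 := by
          rw [Finset.mul_sum]
          exact Finset.sum_congr rfl fun s _ => by ring
      _ = N ^ 2 := by
          rw [hc, sum_sq_walsh_coeff, Finset.sum_congr rfl fun y _ => hD y, Finset.sum_const,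
            Finset.card_univ, nsmul_eq_mul, Fintype.card_fun, Fintype.card_units_int]
          push_cast
          rw [← hN]
          ring
  refine le_of_mul_le_mul_left ?_ (pow_pos hNpos 2)
  rw [← mul_pow, hsum]
  refine (Finset.sum_mul_sq_le_sq_mul_sq _ _ _).trans ?_
  exact mul_le_mul_of_nonneg_right hpars (Finset.sum_nonneg fun _ _ => sq_nonneg _)

/-- The Fourier weight of the indicator function of `A` on level `k`, unnormalized. -/
def levelWeight {ι : Type*} [Fintype ι] (A : Finset (ι → ℤˣ)) (k : ℕ) : ℝ :=
  ∑ S ∈ Finset.powersetCard k Finset.univ, fourierCount A S ^ 2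

variable [DecidableEq κ]

/-- If every `π k` is a uniformly random permutation, independently of the others, then the images
`π k '' J` of a set `J` form a uniformly random tuple of sets of the size of `J`. -/
lemma sum_perm_map (F : (κ → Finset α) → ℝ) (J : Finset α) :
    ((Fintype.card α).choose J.card : ℝ) ^ Fintype.card κ *
        ∑ π : κ → Equiv.Perm α, F (fun k => J.map (π k).toEmbedding)
      = Fintype.card (κ → Equiv.Perm α) *
        ∑ T ∈ Fintype.piFinset fun _ : κ => Finset.powersetCard J.card Finset.univ, F T := by
  set P := Fintype.piFinset fun _ : κ => Finset.powersetCard J.card (Finset.univ : Finset α)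
    with hP
  have hcard : P.card = (Fintype.card α).choose J.card ^ Fintype.card κ := by
    simp [hP, Fintype.card_piFinset, Finset.card_univ]
  -- the sum over `π` does not change if the constant tuple `J` is replaced by any tuple in `P`
  have hinv : ∀ T ∈ P, ∑ π : κ → Equiv.Perm α, F (fun k => (T k).map (π k).toEmbedding)
      = ∑ π : κ → Equiv.Perm α, F (fun k => J.map (π k).toEmbedding) := by
    intro T hT
    have : ∀ k, ∃ σ : Equiv.Perm α, J.map σ.toEmbedding = T k := fun k =>
      exists_perm_map_eq (Finset.mem_powersetCard.mp (Fintype.mem_piFinset.mp hT k)).2.symm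
    choose σ hσ using this
    rw [← Equiv.sum_comp (Equiv.mulRight σ) fun π : κ → Equiv.Perm α =>
      F (fun k => J.map (π k).toEmbedding)]
    refine Finset.sum_congr rfl fun π _ => ?_
    congr 1
    funext k
    rw [← hσ k, Finset.map_map]
    rfl
  have hperm : ∀ π : κ → Equiv.Perm α,
      ∑ T ∈ P, F (fun k => (T k).map (π k).toEmbedding) = ∑ T ∈ P, F T := by
    intro π
    refine Finset.sum_nbij' (fun T k => (T k).map (π k).toEmbedding)
      (fun T k => (T k).map (π k).symm.toEmbedding) ?_ ?_ ?_ ?_ (fun T _ => rfl)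
    · intro T hT
      simpa [hP] using hT
    · intro T hT
      simpa [hP] using hT
    · intro T _
      funext k
      rw [Finset.map_map]
      simp
    · intro T _
      funext k
      rw [Finset.map_map]
      simp
  calc _ = ∑ T ∈ P, ∑ π : κ → Equiv.Perm α, F (fun k => (T k).map (π k).toEmbedding) := by
        rw [Finset.sum_congr rfl hinv, Finset.sum_const, hcard, nsmul_eq_mul]
        push_cast
        rfl
    _ = _ := by
        rw [Finset.sum_comm, Finset.sum_congr rfl fun π _ => hperm π, Finset.sum_const,
          nsmul_eq_mul, Finset.card_univ]

lemma sum_tuple_fourierCount_le (A : Finset (κ × α → ℤˣ)) (l : ℕ) :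
    ∑ T ∈ Fintype.piFinset fun _ : κ => Finset.powersetCard l Finset.univ,
        fourierCount A (tupleSet T) ^ 2 ≤ levelWeight A (Fintype.card κ * l) := by
  rw [levelWeight, ← Finset.sum_image (f := fun S => fourierCount A S ^ 2)
    (tupleSet_injective.injOn)]
  refine Finset.sum_le_sum_of_subset_of_nonneg ?_ fun _ _ _ => sq_nonneg _
  intro S hS
  obtain ⟨T, hT, rfl⟩ := Finset.mem_image.mp hS
  rw [Fintype.mem_piFinset] at hT
  refine Finset.mem_powersetCard.mpr ⟨Finset.subset_univ _, ?_⟩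
  rw [card_tupleSet, Finset.sum_congr rfl fun k _ => (Finset.mem_powersetCard.mp (hT k)).2]
  simp

lemma sum_perm_odd_le [Nonempty κ] (A : Finset (κ × α → ℤˣ)) :
    ∑ π : κ → Equiv.Perm α, ∑ s : Finset α with Odd s.card,
        fourierCount A (tupleSet fun k => s.map (π k).toEmbedding) ^ 2
      ≤ Fintype.card (κ → Equiv.Perm α) *
        ∑ l ∈ Finset.range (Fintype.card α + 1) with Odd l,
          levelWeight A (Fintype.card κ * l) /
            ((Fintype.card α).choose l : ℝ) ^ (Fintype.card κ - 1) := by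
  rw [Finset.sum_comm, Finset.sum_filter,
    ← Finset.powerset_univ, Finset.sum_powerset, Finset.sum_filter, Finset.mul_sum,
    Finset.card_univ]
  refine Finset.sum_le_sum fun l hl => ?_
  have hl' : l ≤ Fintype.card α := by simpa [Nat.lt_succ_iff] using hl
  by_cases hodd : Odd l
  swap
  · rw [if_neg hodd, mul_zero]
    refine (Finset.sum_eq_zero fun s hs => ?_).le
    rw [(Finset.mem_powersetCard.mp hs).2, if_neg hodd]
  rw [if_pos hodd]
  set C : ℝ := ((Fintype.card α).choose l : ℝ) with hC
  have hCpos : 0 < C := Nat.cast_pos.mpr (Nat.choose_pos hl')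
  obtain ⟨r, hr⟩ : ∃ r, Fintype.card κ = r + 1 := ⟨_, (Nat.succ_pred_eq_of_pos Fintype.card_pos).symm⟩
  have hs : ∀ s ∈ Finset.powersetCard l (Finset.univ : Finset α),
      (if Odd s.card then ∑ π : κ → Equiv.Perm α,
        fourierCount A (tupleSet fun k => s.map (π k).toEmbedding) ^ 2 else 0)
      ≤ Fintype.card (κ → Equiv.Perm α) * levelWeight A (Fintype.card κ * l) / C ^ (r + 1) := by
    intro s hs
    have hcard := (Finset.mem_powersetCard.mp hs).2
    rw [hcard, if_pos hodd, le_div_iff₀ (pow_pos hCpos _), mul_comm]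
    have h := sum_perm_map (fun T : κ → Finset α => fourierCount A (tupleSet T) ^ 2) s
    rw [hcard, ← hC] at h
    rw [← hr, h]
    exact mul_le_mul_of_nonneg_left (sum_tuple_fourierCount_le A l) (Nat.cast_nonneg _)
  refine (Finset.sum_le_sum hs).trans (le_of_eq ?_)
  rw [Finset.sum_const, Finset.card_powersetCard, nsmul_eq_mul, Finset.card_univ, ← hC, hr,
    Nat.add_sub_cancel, pow_succ]
  field_simp

end Matching

/-! ### Binomial coefficients and the choice of the exponent -/

section Numerics

lemma pow_le_choose_mul_pow (m l : ℕ) (h : l ≤ m) : m ^ l ≤ m.choose l * l ^ l := by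
  have h1 : m ^ l * l.factorial ≤ l ^ l * m.descFactorial l := by
    rw [← Nat.descFactorial_self l, Nat.descFactorial_eq_prod_range,
      Nat.descFactorial_eq_prod_range]
    have hpow : ∀ a : ℕ, a ^ l = ∏ _i ∈ Finset.range l, a := fun a => by simp
    rw [hpow m, hpow l, ← Finset.prod_mul_distrib, ← Finset.prod_mul_distrib]
    refine Finset.prod_le_prod' fun i hi => ?_
    have : i < l := Finset.mem_range.mp hi
    rw [Nat.mul_sub, Nat.mul_sub, mul_comm m l]
    exact Nat.sub_le_sub_left (Nat.mul_le_mul_right i h) _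
  rw [Nat.descFactorial_eq_factorial_mul_choose] at h1
  refine Nat.le_of_mul_le_mul_right ?_ l.factorial_pos
  calc _ ≤ _ := h1
    _ = _ := by ring

lemma choose_le_choose_of_le_half {m a b : ℕ} (hab : a ≤ b) (hb : 2 * b ≤ m) :
    m.choose a ≤ m.choose b := by
  induction b, hab using Nat.le_induction with
  | base => exact le_rfl
  | succ b _ ih =>
    exact (ih (by omega)).trans (Nat.choose_le_succ_of_lt_half_left (by omega))

/-- The choice of the exponent in the level inequality: for messages of `S` bits, hyperedges of
size `t` and level `l`, the factor `(2 * q - 1) ^ (t * l) * R` of the level inequality is beaten by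
the probability `1 / m.choose l ^ (t - 1)` that a given tuple of `l`-sets is matched. -/
lemma exists_exponent {t m S l : ℕ} (ht : 2 ≤ t) (hS : 2 * t ≤ S) (hm : (24 * S) ^ t ≤ m ^ (t - 1))
    (hl : 1 ≤ l) (hlm : 2 * l ≤ m) :
    ∃ q : ℕ, 1 ≤ q ∧ ∃ R : ℝ, 0 ≤ R ∧ (2 : ℝ) ^ S ≤ R ^ q ∧
      (2 * q - 1 : ℝ) ^ (t * l) * R / (m.choose l : ℝ) ^ (t - 1) ≤ (1 / 32) ^ l + 1 / (m : ℝ) ^ 2 := by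
  obtain ⟨r, rfl⟩ : ∃ r, t = r + 1 := ⟨t - 1, by omega⟩
  rw [Nat.add_sub_cancel] at hm ⊢
  have hC : 0 < m.choose l := Nat.choose_pos (by omega)
  have hmpos : (0 : ℝ) < m := by exact_mod_cast (by omega : 0 < m)
  rcases Nat.lt_or_ge S l with h | h
  · -- high levels: Parseval suffices, since `m.choose l ≥ m.choose (S + 1) ≥ 2 ^ S * m ^ 2`
    refine ⟨1, le_rfl, 2 ^ S, by positivity, by simp, ?_⟩
    have h1 : 2 ^ S * m ^ 2 ≤ m.choose (S + 1) := by
      have hb : (2 * (S + 1)) ^ (r + 1) ≤ m ^ r :=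
        (Nat.pow_le_pow_left (by omega) _).trans hm
      have hbm : 2 * (S + 1) ≤ m := by omega
      obtain ⟨e, he⟩ : ∃ e, S + 1 = (r + 1) * 2 + e := ⟨S + 1 - (r + 1) * 2, by omega⟩
      have h2 : (2 * (S + 1)) ^ (S + 1) * m ^ 2 ≤ m ^ (S + 1) := by
        calc (2 * (S + 1)) ^ (S + 1) * m ^ 2
            = ((2 * (S + 1)) ^ (r + 1)) ^ 2 * (2 * (S + 1)) ^ e * m ^ 2 := by
              rw [← pow_mul, ← pow_add, ← he]
          _ ≤ (m ^ r) ^ 2 * m ^ e * m ^ 2 := by gcongr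
          _ = m ^ (S + 1) := by
              rw [he, ← pow_mul, ← pow_add, ← pow_add]
              congr 1
              ring
      have h3 := pow_le_choose_mul_pow m (S + 1) (by omega)
      refine Nat.le_of_mul_le_mul_right (c := (S + 1) ^ (S + 1)) ?_ (by positivity)
      calc 2 ^ S * m ^ 2 * (S + 1) ^ (S + 1) ≤ 2 ^ (S + 1) * m ^ 2 * (S + 1) ^ (S + 1) := by
            gcongr <;> omega
        _ = (2 * (S + 1)) ^ (S + 1) * m ^ 2 := by rw [mul_pow]; ring
        _ ≤ _ := h2.trans h3
    have h4 : 2 ^ S * m ^ 2 ≤ m.choose l ^ r :=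
      (h1.trans (choose_le_choose_of_le_half (by omega) hlm)).trans
        (Nat.le_self_pow (by omega) _)
    have h5 : (2 : ℝ) ^ S * (m : ℝ) ^ 2 ≤ (m.choose l : ℝ) ^ r := by exact_mod_cast h4
    have hC' : (0 : ℝ) < (m.choose l : ℝ) ^ r := by positivity
    norm_num
    rw [div_le_iff₀ hC']
    have : (2 : ℝ) ^ S ≤ ((m : ℝ) ^ 2)⁻¹ * (m.choose l : ℝ) ^ r := by
      rw [inv_mul_eq_div, le_div_iff₀ (by positivity)]
      exact h5
    refine this.trans (mul_le_mul_of_nonneg_right ?_ hC'.le)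
    have : (0 : ℝ) ≤ (1 / 32) ^ l := by positivity
    linarith
  · -- low levels: take `q` to be `S / l` rounded up, and `R = 2 ^ l`
    obtain ⟨q, hq1, hq2⟩ : ∃ q, S ≤ q * l ∧ q * l + 1 ≤ S + l := by
      refine ⟨(S + l - 1) / l, ?_, ?_⟩
      · have := Nat.lt_div_mul_add (a := S + l - 1) (by omega : 0 < l)
        omega
      · have := Nat.div_mul_le_self (S + l - 1) l
        omega
    have hq : 1 ≤ q := by
      rcases Nat.eq_zero_or_pos q with rfl | h'
      · omega
      · exact h'
    refine ⟨q, hq, 2 ^ l, by positivity, ?_, ?_⟩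
    · rw [← pow_mul, mul_comm l q]
      exact pow_le_pow_right₀ (by norm_num) hq1
    obtain ⟨p, hp⟩ : ∃ p, 2 * q = p + 1 := ⟨2 * q - 1, by omega⟩
    have hpR : (2 * q - 1 : ℝ) = p := by
      have : (2 * q : ℝ) = p + 1 := by exact_mod_cast hp
      linarith
    have hpl : p * l ≤ 3 * S := by
      have : (p + 1) * l = 2 * (q * l) := by rw [← hp]; ring
      rw [Nat.add_mul] at this
      omega
    have h8 : 64 ≤ 8 ^ (r + 1) :=
      (by norm_num : 64 = 8 ^ 2).le.trans (Nat.pow_le_pow_right (by norm_num) ht)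
    have hbase : 32 * (2 * (3 * S) ^ (r + 1)) ≤ m ^ r := by
      calc 32 * (2 * (3 * S) ^ (r + 1)) = 64 * (3 * S) ^ (r + 1) := by ring
        _ ≤ 8 ^ (r + 1) * (3 * S) ^ (r + 1) := Nat.mul_le_mul_right _ h8
        _ = (24 * S) ^ (r + 1) := by rw [← mul_pow]; congr 1; ring
        _ ≤ _ := hm
    have hmain : p ^ ((r + 1) * l) * 2 ^ l * 32 ^ l ≤ m.choose l ^ r := by
      refine Nat.le_of_mul_le_mul_right (c := l ^ ((r + 1) * l)) ?_ (by positivity)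
      calc p ^ ((r + 1) * l) * 2 ^ l * 32 ^ l * l ^ ((r + 1) * l)
          = (p * l) ^ ((r + 1) * l) * 2 ^ l * 32 ^ l := by rw [mul_pow]; ring
        _ ≤ (3 * S) ^ ((r + 1) * l) * 2 ^ l * 32 ^ l := by gcongr
        _ = (32 * (2 * (3 * S) ^ (r + 1))) ^ l := by
          rw [pow_mul, mul_pow 32, mul_pow 2]; generalize ((3 * S) ^ (r + 1)) ^ l = y; ring
        _ ≤ (m ^ r) ^ l := Nat.pow_le_pow_left hbase l
        _ = (m ^ l) ^ r := by rw [← pow_mul, ← pow_mul, mul_comm]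
        _ ≤ (m.choose l * l ^ l) ^ r := Nat.pow_le_pow_left (pow_le_choose_mul_pow m l (by omega)) r
        _ = m.choose l ^ r * l ^ (l * r) := by rw [mul_pow, ← pow_mul]
        _ ≤ m.choose l ^ r * l ^ ((r + 1) * l) :=
          Nat.mul_le_mul_left _ (Nat.pow_le_pow_right hl (by nlinarith))
    have hmain' : (p : ℝ) ^ ((r + 1) * l) * 2 ^ l * 32 ^ l ≤ (m.choose l : ℝ) ^ r := by
      exact_mod_cast hmain
    have hC' : (0 : ℝ) < (m.choose l : ℝ) ^ r := by positivity
    rw [hpR, div_le_iff₀ hC']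
    have h32 : (p : ℝ) ^ ((r + 1) * l) * 2 ^ l ≤ (1 / 32) ^ l * (m.choose l : ℝ) ^ r := by
      rw [one_div, inv_pow, inv_mul_eq_div, le_div_iff₀ (by positivity)]
      exact hmain'
    refine h32.trans (mul_le_mul_of_nonneg_right ?_ hC'.le)
    have : (0 : ℝ) ≤ 1 / (m : ℝ) ^ 2 := by positivity
    linarith

end Numerics

/-! ### The communication lower bound -/

section Protocol

/-- Averaging of the level inequality over the messages: `c a` is the number of inputs with message
`a`, `N` the number of all inputs and `W a` a level weight. The bound depends on the
number of messages only through its `q`-th root. -/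
lemma sum_weight_div_le {M : Type*} [Fintype M] (c W : M → ℝ) (N L R : ℝ) (q : ℕ) (hq : 1 ≤ q)
    (hc : ∀ a, 0 ≤ c a) (hN : 0 < N) (hcN : ∑ a, c a = N) (hL : 0 < L) (hR : 0 ≤ R)
    (hW0 : ∀ a, 0 ≤ W a) (hW : ∀ a, W a ^ q ≤ c a ^ (2 * q - 1) * N * L ^ q)
    (hM : (Fintype.card M : ℝ) ≤ R ^ q) :
    ∑ a, W a / c a ≤ N * L * R := by
  set p : M → ℝ := fun a => c a / N with hp
  set V : M → ℝ := fun a => W a / (c a ^ 2 * L) with hV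
  have hp0 : ∀ a, 0 ≤ p a := fun a => div_nonneg (hc a) hN.le
  have hV0 : ∀ a, 0 ≤ V a := fun a => div_nonneg (hW0 a) (mul_nonneg (sq_nonneg _) hL.le)
  have hp1 : ∑ a, p a = 1 := by rw [← Finset.sum_div, hcN, div_self hN.ne']
  have hterm : ∀ a, W a / c a = N * L * (p a * V a) := by
    intro a
    rcases (hc a).eq_or_lt with h | h
    · simp [hp, hV, ← h]
    · simp only [hp, hV]
      field_simp
  have hone : ∀ a, p a * V a ^ q ≤ 1 := by
    intro a
    rcases (hc a).eq_or_lt with h | h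
    · simp [hp, ← h]
    · have h1 : V a ^ q ≤ N / c a := by
        rw [hV, div_pow, div_le_div_iff₀ (by positivity) h]
        calc W a ^ q * c a ≤ c a ^ (2 * q - 1) * N * L ^ q * c a :=
              mul_le_mul_of_nonneg_right (hW a) h.le
          _ = N * (c a ^ 2 * L) ^ q := by
              obtain ⟨e, he⟩ : ∃ e, 2 * q = e + 1 := ⟨2 * q - 1, by omega⟩
              rw [mul_pow, ← pow_mul, he, Nat.add_sub_cancel, pow_succ]
              ring
      calc p a * V a ^ q ≤ p a * (N / c a) := mul_le_mul_of_nonneg_left h1 (hp0 a)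
        _ = 1 := by simp only [hp]; field_simp
  have hjensen : (∑ a, p a * V a) ^ q ≤ R ^ q := by
    refine (Real.pow_arith_mean_le_arith_mean_pow Finset.univ p V (fun a _ => hp0 a) hp1
      (fun a _ => hV0 a) q).trans ?_
    refine le_trans ?_ hM
    calc ∑ a, p a * V a ^ q ≤ ∑ _a : M, (1 : ℝ) := Finset.sum_le_sum fun a _ => hone a
      _ = Fintype.card M := by simp
  rw [Finset.sum_congr rfl fun a _ => hterm a, ← Finset.mul_sum]
  exact mul_le_mul_of_nonneg_left (le_of_pow_le_pow_left₀ (by omega) hR hjensen) (by positivity)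

variable {κ α M : Type*} [Fintype κ] [Fintype α] [DecidableEq κ] [DecidableEq α]
  [Fintype M] [DecidableEq M]

/-- The average level weight of the fibres of a message function with few values, on a level
`l ≠ 0, |α|` and divided by the number of tuples of `l`-sets. -/
lemma sum_levelWeight_div_le {S : ℕ} (msg : (κ × α → ℤˣ) → M) (hκ : 2 ≤ Fintype.card κ)
    (hS : 2 * Fintype.card κ ≤ S)
    (hm : (24 * S) ^ Fintype.card κ ≤ Fintype.card α ^ (Fintype.card κ - 1))
    (hM : Fintype.card M ≤ 2 ^ S) {l : ℕ} (hl : 1 ≤ l) (hlm : l < Fintype.card α) :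
    (∑ a, levelWeight (Finset.univ.filter fun x => msg x = a) (Fintype.card κ * l) /
        ((Finset.univ.filter fun x => msg x = a).card : ℝ)) /
          ((Fintype.card α).choose l : ℝ) ^ (Fintype.card κ - 1)
      ≤ Fintype.card (κ × α → ℤˣ) *
        ((1 / 32) ^ l + (1 / 32) ^ (Fintype.card α - l) + 1 / (Fintype.card α : ℝ) ^ 2) := by
  set t := Fintype.card κ with ht
  set m := Fintype.card α with hmdef
  set A : M → Finset (κ × α → ℤˣ) := fun a => Finset.univ.filter fun x => msg x = a with hA
  have hsumA : ∑ a, ((A a).card : ℝ) = Fintype.card (κ × α → ℤˣ) := by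
    have h := Finset.card_eq_sum_card_fiberwise (f := msg) (s := Finset.univ)
      (t := (Finset.univ : Finset M)) (fun _ _ => Finset.mem_coe.mpr (Finset.mem_univ _))
    rw [← Finset.card_univ, h]
    push_cast
    rfl
  have hN : (0 : ℝ) < Fintype.card (κ × α → ℤˣ) := by exact_mod_cast Fintype.card_pos
  have hcard : Fintype.card (κ × α) = t * m := Fintype.card_prod κ α
  -- levels above the middle are reflected
  have main : ∀ l', 1 ≤ l' → 2 * l' ≤ m → m.choose l' = m.choose l →
      (∀ a (q : ℕ), 1 ≤ q → levelWeight (A a) (t * l) ^ q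
        ≤ ((A a).card : ℝ) ^ (2 * q - 1) * Fintype.card (κ × α → ℤˣ)
          * ((2 * q - 1 : ℝ) ^ (t * l')) ^ q) →
      (∑ a, levelWeight (A a) (t * l) / ((A a).card : ℝ)) / (m.choose l : ℝ) ^ (t - 1)
        ≤ Fintype.card (κ × α → ℤˣ) * ((1 / 32) ^ l' + 1 / (m : ℝ) ^ 2) := by
    intro l' h1 h2 hch hlev
    obtain ⟨q, hq, R, hR, hSR, hbound⟩ := exists_exponent hκ hS hm h1 h2
    have hq' : (1 : ℝ) ≤ q := by exact_mod_cast hq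
    have h := sum_weight_div_le (fun a => ((A a).card : ℝ)) (fun a => levelWeight (A a) (t * l))
      (Fintype.card (κ × α → ℤˣ)) ((2 * q - 1 : ℝ) ^ (t * l')) R q hq (fun a => Nat.cast_nonneg _)
      hN hsumA (pow_pos (by linarith) _) hR (fun a => Finset.sum_nonneg fun _ _ => sq_nonneg _)
      (fun a => hlev a q hq) (le_trans (by exact_mod_cast hM) hSR)
    rw [hch] at hbound
    have hC : (0 : ℝ) ≤ (m.choose l : ℝ) ^ (t - 1) := by positivity
    calc _ ≤ Fintype.card (κ × α → ℤˣ) * (2 * q - 1 : ℝ) ^ (t * l') * R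
          / (m.choose l : ℝ) ^ (t - 1) := div_le_div_of_nonneg_right h hC
      _ = Fintype.card (κ × α → ℤˣ) * ((2 * q - 1 : ℝ) ^ (t * l') * R
          / (m.choose l : ℝ) ^ (t - 1)) := by ring
      _ ≤ _ := mul_le_mul_of_nonneg_left hbound hN.le
  rcases Nat.lt_or_ge m (2 * l) with h | h
  · refine (main (m - l) (by omega) (by omega) (Nat.choose_symm hlm.le) ?_).trans ?_
    · intro a q hq
      have := level_inequality_compl (A a) (t * (m - l)) q hq
        (by rw [hcard]; exact Nat.mul_le_mul_left t (Nat.sub_le m l))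
      rwa [hcard, ← Nat.mul_sub, Nat.sub_sub_self hlm.le] at this
    · refine mul_le_mul_of_nonneg_left ?_ hN.le
      have : (0 : ℝ) ≤ (1 / 32) ^ l := by positivity
      linarith
  · refine (main l hl h rfl fun a q hq => level_inequality (A a) (t * l) q hq).trans ?_
    refine mul_le_mul_of_nonneg_left ?_ hN.le
    have : (0 : ℝ) ≤ (1 / 32) ^ (m - l) := by positivity
    linarith

lemma sum_error_lt {m : ℕ} (hm : 9 ≤ m) :
    ∑ l ∈ Finset.Ico 1 m, ((1 / 32 : ℝ) ^ l + (1 / 32) ^ (m - l) + 1 / (m : ℝ) ^ 2) < 1 / 4 := by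
  have hgeo : ∑ l ∈ Finset.Ico 1 m, (1 / 32 : ℝ) ^ l ≤ 1 / 31 := by
    rw [geom_sum_Ico (by norm_num) (by omega)]
    rw [div_le_iff_of_neg (by norm_num)]
    have : (0 : ℝ) ≤ (1 / 32) ^ m := by positivity
    norm_num at this ⊢
  have hrefl : ∑ l ∈ Finset.Ico 1 m, (1 / 32 : ℝ) ^ (m - l)
      = ∑ l ∈ Finset.Ico 1 m, (1 / 32 : ℝ) ^ l := by
    refine Finset.sum_nbij' (fun l => m - l) (fun l => m - l) ?_ ?_ ?_ ?_ ?_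
    all_goals
      intro l hl
      simp only [Finset.mem_Ico] at hl ⊢
      try omega
  have hm' : (9 : ℝ) ≤ m := by exact_mod_cast hm
  have hconst : ∑ _l ∈ Finset.Ico 1 m, 1 / (m : ℝ) ^ 2 ≤ 1 / 9 := by
    rw [Finset.sum_const, Nat.card_Ico, nsmul_eq_mul, mul_one_div, div_le_div_iff₀ (by positivity)
      (by norm_num), Nat.cast_sub (by omega)]
    push_cast
    nlinarith
  rw [Finset.sum_add_distrib, Finset.sum_add_distrib, hrefl]
  linarith

/-- The communication lower bound for the hidden matching problem. The input `x` is compressed to a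
message with at most `2 ^ S` values; from the message, the matching `π` and either the hidden
parities or their negatives, no decision rule tells the two cases apart with advantage `1 / 2`. -/
theorem advantage_lt {S : ℕ} (msg : (κ × α → ℤˣ) → M)
    (D : M → (κ → Equiv.Perm α) → (α → ℤˣ) → ℝ) (hD : ∀ a π w, D a π w ^ 2 = 1 / 4)
    (hκ : 2 ≤ Fintype.card κ) (hS : 2 * Fintype.card κ ≤ S)
    (hm : (24 * S) ^ Fintype.card κ ≤ Fintype.card α ^ (Fintype.card κ - 1))
    (hα : Even (Fintype.card α)) (hα9 : 9 ≤ Fintype.card α) (hM : Fintype.card M ≤ 2 ^ S) :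
    ∑ π : κ → Equiv.Perm α, ∑ x : κ × α → ℤˣ,
        (D (msg x) π (-hiddenParity π x) - D (msg x) π (hiddenParity π x))
      < 1 / 2 * (Fintype.card (κ → Equiv.Perm α) * Fintype.card (κ × α → ℤˣ)) := by
  have : Nonempty κ := Fintype.card_pos_iff.mp (by omega)
  set A : M → Finset (κ × α → ℤˣ) := fun a => Finset.univ.filter fun x => msg x = a with hA
  set P : ℝ := ((Fintype.card (κ → Equiv.Perm α) : ℕ) : ℝ) with hP
  set N : ℝ := ((Fintype.card (κ × α → ℤˣ) : ℕ) : ℝ) with hNdef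
  have hN : 0 < N := by simp only [hNdef]; exact_mod_cast Fintype.card_pos
  have hPpos : 0 < P := by simp only [hP]; exact_mod_cast Fintype.card_pos
  set Δ : M → (κ → Equiv.Perm α) → ℝ := fun a π =>
    ∑ x ∈ A a, (D a π (-hiddenParity π x) - D a π (hiddenParity π x)) with hΔ
  have hsplit : ∀ (f : M → (κ × α → ℤˣ) → ℝ), ∑ x, f (msg x) x = ∑ a, ∑ x ∈ A a, f a x := by
    intro f
    rw [← Finset.sum_fiberwise Finset.univ msg]
    refine Finset.sum_congr rfl fun a _ => Finset.sum_congr rfl fun x hx => ?_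
    rw [(Finset.mem_filter.mp hx).2]
  have hsumA : ∑ a, ((A a).card : ℝ) = N := by
    have := hsplit fun _ _ => 1
    simpa [hNdef, eq_comm] using this
  have hT : ∑ π : κ → Equiv.Perm α, ∑ x : κ × α → ℤˣ,
        (D (msg x) π (-hiddenParity π x) - D (msg x) π (hiddenParity π x))
      = ∑ p : (κ → Equiv.Perm α) × M, Δ p.2 p.1 := by
    rw [Fintype.sum_prod_type]
    exact Finset.sum_congr rfl fun π _ =>
      hsplit fun a x => D a π (-hiddenParity π x) - D a π (hiddenParity π x)
  rw [hT]
  -- Cauchy-Schwarz, each message weighted by the number of its inputs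
  have hCS : (∑ p : (κ → Equiv.Perm α) × M, Δ p.2 p.1) ^ 2
      ≤ (∑ p : (κ → Equiv.Perm α) × M, ((A p.2).card : ℝ))
        * ∑ p : (κ → Equiv.Perm α) × M, Δ p.2 p.1 ^ 2 / (A p.2).card := by
    refine Finset.sum_sq_le_sum_mul_sum_of_sq_le_mul _ (fun _ _ => Nat.cast_nonneg _)
      (fun _ _ => div_nonneg (sq_nonneg _) (Nat.cast_nonneg _)) fun p _ => ?_
    rcases Finset.eq_empty_or_nonempty (A p.2) with h | h
    · simp [hΔ, h]
    · have : ((A p.2).card : ℝ) ≠ 0 := by exact_mod_cast h.card_pos.ne'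
      exact (mul_div_cancel₀ _ this).ge
  have hfst : ∑ p : (κ → Equiv.Perm α) × M, ((A p.2).card : ℝ) = P * N := by
    rw [Fintype.sum_prod_type]
    simp only [hsumA, Finset.sum_const, Finset.card_univ, nsmul_eq_mul, hP]
  have hlev : ∀ a, ∑ π, Δ a π ^ 2 ≤ P * ∑ l ∈ Finset.range (Fintype.card α + 1) with Odd l,
      levelWeight (A a) (Fintype.card κ * l) /
        ((Fintype.card α).choose l : ℝ) ^ (Fintype.card κ - 1) := fun a =>
    (Finset.sum_le_sum fun π _ => sq_advantage_le (A a) π (D a π) (hD a π)).trans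
      (sum_perm_odd_le (A a))
  have hsnd : ∑ p : (κ → Equiv.Perm α) × M, Δ p.2 p.1 ^ 2 / (A p.2).card < P * N * (1 / 4) := by
    rw [Fintype.sum_prod_type_right]
    calc ∑ a, ∑ π, Δ a π ^ 2 / ((A a).card : ℝ)
        ≤ ∑ a, (P * ∑ l ∈ Finset.range (Fintype.card α + 1) with Odd l,
            levelWeight (A a) (Fintype.card κ * l) /
              ((Fintype.card α).choose l : ℝ) ^ (Fintype.card κ - 1)) / ((A a).card : ℝ) :=
          Finset.sum_le_sum fun a _ => by
            rw [← Finset.sum_div]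
            exact div_le_div_of_nonneg_right (hlev a) (Nat.cast_nonneg _)
      _ = P * ∑ l ∈ Finset.range (Fintype.card α + 1) with Odd l,
            (∑ a, levelWeight (A a) (Fintype.card κ * l) / ((A a).card : ℝ)) /
              ((Fintype.card α).choose l : ℝ) ^ (Fintype.card κ - 1) := by
          simp_rw [mul_div_assoc, Finset.sum_div]
          rw [← Finset.mul_sum, Finset.sum_comm]
          congr 1
          refine Finset.sum_congr rfl fun l _ => Finset.sum_congr rfl fun a _ => ?_
          rw [div_right_comm]
      _ ≤ P * ∑ l ∈ Finset.range (Fintype.card α + 1) with Odd l,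
            N * ((1 / 32) ^ l + (1 / 32) ^ (Fintype.card α - l)
              + 1 / (Fintype.card α : ℝ) ^ 2) := by
          refine mul_le_mul_of_nonneg_left (Finset.sum_le_sum fun l hl => ?_) hPpos.le
          obtain ⟨h1, h2⟩ := Finset.mem_filter.mp hl
          -- the top level does not occur, since `|α|` is even and `l` is odd
          have hne : l ≠ Fintype.card α := fun h => Nat.not_even_iff_odd.mpr h2 (h ▸ hα)
          have : l < Fintype.card α + 1 := Finset.mem_range.mp h1
          exact sum_levelWeight_div_le msg hκ hS hm hM h2.pos (by omega)
      _ ≤ P * ∑ l ∈ Finset.Ico 1 (Fintype.card α),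
            N * ((1 / 32) ^ l + (1 / 32) ^ (Fintype.card α - l)
              + 1 / (Fintype.card α : ℝ) ^ 2) := by
          refine mul_le_mul_of_nonneg_left (Finset.sum_le_sum_of_subset_of_nonneg ?_
            fun _ _ _ => by positivity) hPpos.le
          intro l hl
          obtain ⟨h1, h2⟩ := Finset.mem_filter.mp hl
          have hne : l ≠ Fintype.card α := fun h => Nat.not_even_iff_odd.mpr h2 (h ▸ hα)
          have : l < Fintype.card α + 1 := Finset.mem_range.mp h1
          have := h2.pos
          exact Finset.mem_Ico.mpr ⟨by omega, by omega⟩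
      _ < P * N * (1 / 4) := by
          rw [← Finset.mul_sum, ← mul_assoc]
          exact mul_lt_mul_of_pos_left (sum_error_lt hα9) (mul_pos hPpos hN)
  have hPN : 0 < P * N := mul_pos hPpos hN
  refine lt_of_pow_lt_pow_left₀ 2 (by positivity) ?_
  calc _ ≤ _ := hCS
    _ < (P * N) * (P * N * (1 / 4)) := by
        rw [hfst]
        exact mul_lt_mul_of_pos_left hsnd hPN
    _ = _ := by ring

end Protocol

/-! ### The maxcut value of a graph with indexed edges -/

section CutCounting

variable {n : ℕ} {E : Type*} [Fintype E] (u v : E → Fin n) (G : SimpleGraph (Fin n))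

lemma card_interedges_compl [DecidableRel G.Adj]
    (hinj : Function.Injective fun e => s(u e, v e))
    (hG : ∀ e, e ∈ G.edgeSet ↔ e ∈ Set.range fun e => s(u e, v e)) (f : Fin n → ℤˣ)
    (P : Finset (Fin n)) (hP : ∀ y, y ∈ P ↔ f y = 1) :
    (G.interedges P Pᶜ).card = (Finset.univ.filter fun e => f (u e) ≠ f (v e)).card := by
  have hne : ∀ y, y ∉ P ↔ f y = -1 := fun y => by
    rw [hP]
    rcases Int.units_eq_one_or (f y) with h | h <;> simp [h]
  symm
  refine Finset.card_bij (fun e _ => if f (u e) = 1 then (u e, v e) else (v e, u e)) ?_ ?_ ?_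
  · intro e he
    have hadj : G.Adj (u e) (v e) := (hG _).mpr ⟨e, rfl⟩
    have he := (Finset.mem_filter.mp he).2
    rw [SimpleGraph.interedges, Rel.mem_interedges_iff]
    rcases Int.units_eq_one_or (f (u e)) with h1 | h1 <;>
      rcases Int.units_eq_one_or (f (v e)) with h2 | h2
    all_goals simp_all [G.adj_comm]
  · intro e _ e' _ h
    refine hinj ?_
    have : ∀ e, s(u e, v e) = Sym2.mk (if f (u e) = 1 then (u e, v e) else (v e, u e)).1
        (if f (u e) = 1 then (u e, v e) else (v e, u e)).2 := by
      intro e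
      split_ifs
      · rfl
      · exact Sym2.eq_swap
    simp only [] at h ⊢
    rw [this e, this e', h]
  · rintro ⟨a, b⟩ hab
    obtain ⟨ha, hb, hadj⟩ := Rel.mem_interedges_iff.mp hab
    simp only [Finset.mem_compl] at ha hb
    rw [hP] at ha
    rw [hne] at hb
    obtain ⟨e, he⟩ := (hG s(a, b)).mp hadj
    simp only [Sym2.eq_iff] at he
    refine ⟨e, ?_, ?_⟩
    · rcases he with ⟨h1, h2⟩ | ⟨h1, h2⟩ <;> simp [h1, h2, ha, hb]
    · rcases he with ⟨h1, h2⟩ | ⟨h1, h2⟩ <;> simp [h1, h2, ha, hb]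

lemma card_cut_le_maxCut (hinj : Function.Injective fun e => s(u e, v e))
    (hG : ∀ e, e ∈ G.edgeSet ↔ e ∈ Set.range fun e => s(u e, v e)) (f : Fin n → ℤˣ) :
    (Finset.univ.filter fun e => f (u e) ≠ f (v e)).card ≤ maxCut G := by
  classical
  rw [← card_interedges_compl u v G hinj hG f (Finset.univ.filter fun y => f y = 1) (by simp)]
  unfold maxCut
  convert Finset.le_sup (f := fun P : Finset (Fin n) => (G.interedges P Pᶜ).card)
    (Finset.mem_univ (Finset.univ.filter fun y => f y = 1))

lemma maxCut_le (hinj : Function.Injective fun e => s(u e, v e))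
    (hG : ∀ e, e ∈ G.edgeSet ↔ e ∈ Set.range fun e => s(u e, v e)) (B : ℕ)
    (h : ∀ f : Fin n → ℤˣ, (Finset.univ.filter fun e => f (u e) ≠ f (v e)).card ≤ B) :
    maxCut G ≤ B := by
  classical
  unfold maxCut
  refine Finset.sup_le fun P _ => ?_
  have hcard := card_interedges_compl u v G hinj hG (fun y => if y ∈ P then 1 else -1) P
    (fun y => by by_cases hy : y ∈ P <;> simp [hy])
  exact hcard.le.trans (h fun y => if y ∈ P then 1 else -1)

end CutCounting

/-! ### The hard graphs -/

section Gadget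

variable {r m : ℕ}

/-- The vertices of the hard graphs: two hubs, and for every level `1, …, 2 * r` (encoded as an
element of `Fin (2 * r)`) and every `i : Fin m` a pair of vertices labelled by signs. -/
abbrev GadgetVertex (r m : ℕ) : Type := ℤˣ ⊕ (Fin (2 * r) × Fin m × ℤˣ)

/-- The vertex of level `L` with index `i` and sign `ε`; at the levels `0` and `2 * r + 1` this is
the hub with sign `ε`, so that the levels close up to a cycle of odd length `2 * r + 1`. -/
def gadgetVertex (L : ℕ) (i : Fin m) (ε : ℤˣ) : GadgetVertex r m :=
  if h : 1 ≤ L ∧ L - 1 < 2 * r then Sum.inr (⟨L - 1, h.2⟩, i, ε) else Sum.inl ε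

lemma gadgetVertex_zero (i : Fin m) (ε : ℤˣ) :
    (gadgetVertex 0 i ε : GadgetVertex r m) = Sum.inl ε := by simp [gadgetVertex]

lemma gadgetVertex_last (i : Fin m) (ε : ℤˣ) :
    (gadgetVertex (2 * r + 1) i ε : GadgetVertex r m) = Sum.inl ε := by simp [gadgetVertex]

lemma gadgetVertex_inj {L : ℕ} (h1 : 1 ≤ L) (h2 : L ≤ 2 * r) {i i' : Fin m} {ε ε' : ℤˣ}
    (h : (gadgetVertex L i ε : GadgetVertex r m) = gadgetVertex L i' ε') : i = i' ∧ ε = ε' := by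
  have hL : 1 ≤ L ∧ L - 1 < 2 * r := ⟨h1, by omega⟩
  simpa [gadgetVertex, hL] using h

/-- The level of a vertex, where the hubs have level `0`. -/
def vertexLevel : GadgetVertex r m → ℕ
  | Sum.inl _ => 0
  | Sum.inr (k, _, _) => k + 1

lemma vertexLevel_gadgetVertex {L : ℕ} (i : Fin m) (ε : ℤˣ) (hL : L ≤ 2 * r + 1) :
    vertexLevel (gadgetVertex L i ε : GadgetVertex r m) = if L = 2 * r + 1 then 0 else L := by
  unfold gadgetVertex
  split_ifs with h1 h2 h2
  · omega
  · simp only [vertexLevel]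
    omega
  · rfl
  · simp only [vertexLevel]
    omega

/-- As the cycle of levels has length at least `3`, an edge between consecutive levels determines
its lower level. -/
lemma gadget_edge_eq (hr : 1 ≤ r) {L L' : ℕ} (hL : L ≤ 2 * r) (hL' : L' ≤ 2 * r)
    {i₁ i₂ i₁' i₂' : Fin m} {ε₁ ε₂ ε₁' ε₂' : ℤˣ}
    (h : s((gadgetVertex L i₁ ε₁ : GadgetVertex r m), gadgetVertex (L + 1) i₂ ε₂)
      = s(gadgetVertex L' i₁' ε₁', gadgetVertex (L' + 1) i₂' ε₂')) :
    L = L' ∧ (gadgetVertex L i₁ ε₁ : GadgetVertex r m) = gadgetVertex L' i₁' ε₁' ∧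
      (gadgetVertex (L + 1) i₂ ε₂ : GadgetVertex r m) = gadgetVertex (L' + 1) i₂' ε₂' := by
  rcases Sym2.eq_iff.mp h with ⟨h1, h2⟩ | ⟨h1, h2⟩
  · refine ⟨?_, h1, h2⟩
    have := congrArg vertexLevel h1
    rw [vertexLevel_gadgetVertex _ _ (by omega), vertexLevel_gadgetVertex _ _ (by omega)] at this
    split_ifs at this <;> omega
  · have e1 := congrArg vertexLevel h1
    have e2 := congrArg vertexLevel h2
    rw [vertexLevel_gadgetVertex _ _ (by omega), vertexLevel_gadgetVertex _ _ (by omega)] at e1 e2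
    split_ifs at e1 e2 <;> omega

/-- Indices of the edges of the hard graphs. The left summand holds the edges that depend only on
`x`, with an index in the even level they start from; the right summand holds those that depend only
on `π` and `w`, with the hyperedge `j` they belong to. -/
abbrev GadgetEdge (r m : ℕ) : Type := (Fin (r + 1) × Fin m × ℤˣ) ⊕ (Fin r × Fin m × ℤˣ)

/-- The ends of the edges that encode `x`: they lead from level `2 * k` to level `2 * k + 1`, stay
at index `i`, and multiply the sign by `x (k, i)`. -/
def inputEnds (x : Fin (r + 1) × Fin m → ℤˣ) (e : Fin (r + 1) × Fin m × ℤˣ) :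
    GadgetVertex r m × GadgetVertex r m :=
  (gadgetVertex (2 * e.1) e.2.1 e.2.2, gadgetVertex (2 * e.1 + 1) e.2.1 (e.2.2 * x (e.1, e.2.1)))

/-- The ends of the edges that encode the matching `π` and the signs `w`: they lead from level
`2 * k + 1` to level `2 * k + 2`, join the indices `π k j` and `π (k + 1) j`, and
multiply the sign by `w j` if `k = 0`. -/
def matchingEnds (π : Fin (r + 1) → Equiv.Perm (Fin m)) (w : Fin m → ℤˣ)
    (e : Fin r × Fin m × ℤˣ) : GadgetVertex r m × GadgetVertex r m :=
  (gadgetVertex (2 * e.1 + 1) (π e.1.castSucc e.2.1) e.2.2,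
    gadgetVertex (2 * e.1 + 1 + 1) (π e.1.succ e.2.1)
      (e.2.2 * if (e.1 : ℕ) = 0 then w e.2.1 else 1))

/-- The ends of all edges of the hard graph. -/
def gadgetEnds (x : Fin (r + 1) × Fin m → ℤˣ) (π : Fin (r + 1) → Equiv.Perm (Fin m))
    (w : Fin m → ℤˣ) : GadgetEdge r m → GadgetVertex r m × GadgetVertex r m :=
  Sum.elim (inputEnds x) (matchingEnds π w)

variable (x : Fin (r + 1) × Fin m → ℤˣ) (π : Fin (r + 1) → Equiv.Perm (Fin m)) (w : Fin m → ℤˣ)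

lemma gadgetEnds_injective (hr : 1 ≤ r) :
    Function.Injective fun e => s((gadgetEnds x π w e).1, (gadgetEnds x π w e).2) := by
  rintro (⟨k, i, ε⟩ | ⟨k, j, ε⟩) (⟨k', i', ε'⟩ | ⟨k', j', ε'⟩) h
  all_goals simp only [gadgetEnds, Sum.elim_inl, Sum.elim_inr, inputEnds, matchingEnds] at h
  · obtain ⟨h1, h2, h3⟩ := gadget_edge_eq hr (by omega) (by omega) h
    obtain rfl : k = k' := Fin.ext (by omega)
    rcases Nat.eq_zero_or_pos (k : ℕ) with hk | hk
    · obtain ⟨rfl, h4⟩ := gadgetVertex_inj (by omega) (by omega) h3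
      rw [mul_right_cancel h4]
    · obtain ⟨rfl, rfl⟩ := gadgetVertex_inj (by omega) (by omega) h2
      rfl
  · have := (gadget_edge_eq hr (by omega) (by omega) h).1
    omega
  · have := (gadget_edge_eq hr (by omega) (by omega) h).1
    omega
  · obtain ⟨h1, h2, -⟩ := gadget_edge_eq hr (by omega) (by omega) h
    obtain rfl : k = k' := Fin.ext (by omega)
    obtain ⟨h4, rfl⟩ := gadgetVertex_inj (by omega) (by omega) h2
    rw [(π k.castSucc).injective h4]

lemma gadgetEnds_ne (hr : 1 ≤ r) (e : GadgetEdge r m) :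
    (gadgetEnds x π w e).1 ≠ (gadgetEnds x π w e).2 := by
  intro h
  have h := congrArg vertexLevel h
  rcases e with ⟨k, i, ε⟩ | ⟨k, j, ε⟩
  all_goals
    simp only [gadgetEnds, Sum.elim_inl, Sum.elim_inr, inputEnds, matchingEnds] at h
    rw [vertexLevel_gadgetVertex _ _ (by omega), vertexLevel_gadgetVertex _ _ (by omega)] at h
    split_ifs at h <;> omega

/-- The sign by which the edge of path `j` from level `L` to level `L + 1` multiplies. -/
def pathStep (j : Fin m) (L : ℕ) : ℤˣ :=
  if Even L then x (Fin.ofNat (r + 1) (L / 2), π (Fin.ofNat (r + 1) (L / 2)) j)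
  else if L = 1 then w j else 1

/-- The sign collected by path `j` between level `0` and level `L`. -/
def pathSign (j : Fin m) (L : ℕ) : ℤˣ := ∏ l ∈ Finset.range L, pathStep x π w j l

/-- The vertex on level `L` of the path that belongs to the `j`-th hyperedge of the matching and
starts at the hub with sign `ε`. -/
def pathVertex (j : Fin m) (ε : ℤˣ) (L : ℕ) : GadgetVertex r m :=
  gadgetVertex L (π (Fin.ofNat (r + 1) (L / 2)) j) (ε * pathSign x π w j L)

lemma pathSign_last (hr : 1 ≤ r) (j : Fin m) :
    pathSign x π w j (2 * r + 1) = hiddenParity π x j * w j := by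
  have key : ∀ k, pathSign x π w j (2 * k + 1)
      = (∏ k' ∈ Finset.range (k + 1), x (Fin.ofNat (r + 1) k', π (Fin.ofNat (r + 1) k') j))
        * if k = 0 then 1 else w j := by
    intro k
    induction k with
    | zero => simp [pathSign, pathStep]
    | succ k ih =>
      rw [pathSign, show 2 * (k + 1) + 1 = 2 * k + 1 + 1 + 1 by ring, Finset.prod_range_succ,
        Finset.prod_range_succ, ← pathSign, ih, Finset.prod_range_succ _ (k + 1)]
      have h1 : pathStep x π w j (2 * k + 1) = if k = 0 then w j else 1 := by
        simp [pathStep]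
      have h2 : pathStep x π w j (2 * k + 1 + 1)
          = x (Fin.ofNat (r + 1) (k + 1), π (Fin.ofNat (r + 1) (k + 1)) j) := by
        have : (2 * k + 1 + 1) / 2 = k + 1 := by omega
        rw [pathStep, if_pos ⟨k + 1, by ring⟩, this]
      rw [h1, h2, if_neg (Nat.succ_ne_zero k)]
      split_ifs <;> simp [mul_comm, mul_left_comm]
  rw [key, if_neg (by omega), hiddenParity, Finset.prod_range]
  congr 1
  refine Finset.prod_congr rfl fun k _ => ?_
  rw [show Fin.ofNat (r + 1) (k : ℕ) = k from Fin.ext (Nat.mod_eq_of_lt k.2)]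

/-- The path, given by the index of its hyperedge and the sign of its initial hub, that an edge
lies on. -/
def edgePath : GadgetEdge r m → Fin m × ℤˣ
  | Sum.inl (k, i, ε) => ((π k).symm i, ε * pathSign x π w ((π k).symm i) (2 * k))
  | Sum.inr (k, j, ε) => (j, ε * pathSign x π w j (2 * k + 1))

lemma mul_units_cancel (a b : ℤˣ) : a * b * b = a := by
  rw [mul_assoc, Int.units_mul_self, mul_one]

lemma gadgetEnds_eq_pathVertex (e : GadgetEdge r m) : ∃ L ≤ 2 * r, gadgetEnds x π w e
    = (pathVertex x π w (edgePath x π w e).1 (edgePath x π w e).2 L,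
      pathVertex x π w (edgePath x π w e).1 (edgePath x π w e).2 (L + 1)) := by
  rcases e with ⟨k, i, ε⟩ | ⟨k, j, ε⟩
  · refine ⟨2 * k, by omega, ?_⟩
    have h0 : 2 * (k : ℕ) / 2 = k := by omega
    have h1 : (2 * (k : ℕ) + 1) / 2 = k := by omega
    have hk : Fin.ofNat (r + 1) (k : ℕ) = k := Fin.ext (Nat.mod_eq_of_lt k.2)
    have hs : pathSign x π w ((π k).symm i) (2 * k + 1)
        = pathSign x π w ((π k).symm i) (2 * k) * x (k, i) := by
      rw [pathSign, Finset.prod_range_succ, ← pathSign, pathStep, if_pos (even_two_mul _), h0, hk,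
        Equiv.apply_symm_apply]
    simp only [gadgetEnds, Sum.elim_inl, inputEnds, edgePath, pathVertex, h0, h1, hk, hs,
      Equiv.apply_symm_apply, ← mul_assoc, mul_units_cancel]
  · refine ⟨2 * k + 1, by omega, ?_⟩
    have h0 : (2 * (k : ℕ) + 1) / 2 = k := by omega
    have h1 : (2 * (k : ℕ) + 1 + 1) / 2 = k + 1 := by omega
    have hk : Fin.ofNat (r + 1) (k : ℕ) = k.castSucc :=
      Fin.ext (Nat.mod_eq_of_lt (by omega : (k : ℕ) < r + 1))
    have hk' : Fin.ofNat (r + 1) ((k : ℕ) + 1) = k.succ :=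
      Fin.ext (Nat.mod_eq_of_lt (by omega : (k : ℕ) + 1 < r + 1))
    have hs : pathSign x π w j (2 * k + 1 + 1)
        = pathSign x π w j (2 * k + 1) * if (k : ℕ) = 0 then w j else 1 := by
      rw [pathSign, Finset.prod_range_succ, ← pathSign]
      simp [pathStep]
    simp only [gadgetEnds, Sum.elim_inr, matchingEnds, edgePath, pathVertex, h0, h1, hk, hk', hs,
      ← mul_assoc, mul_units_cancel]

lemma exists_edge_of_path (j : Fin m) (ε : ℤˣ) {L : ℕ} (hL : L ≤ 2 * r) :
    ∃ e, edgePath x π w e = (j, ε) ∧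
      gadgetEnds x π w e = (pathVertex x π w j ε L, pathVertex x π w j ε (L + 1)) := by
  rcases Nat.even_or_odd' L with ⟨k, rfl | rfl⟩
  · have h0 : 2 * k / 2 = k := by omega
    have h1 : (2 * k + 1) / 2 = k := by omega
    have hk : Fin.ofNat (r + 1) k = ⟨k, by omega⟩ := Fin.ext (Nat.mod_eq_of_lt (by omega))
    refine ⟨Sum.inl (⟨k, by omega⟩, π ⟨k, by omega⟩ j, ε * pathSign x π w j (2 * k)), ?_, ?_⟩
    · simp [edgePath, mul_units_cancel]
    · have hs : pathSign x π w j (2 * k + 1)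
          = pathSign x π w j (2 * k) * x (⟨k, by omega⟩, π ⟨k, by omega⟩ j) := by
        rw [pathSign, Finset.prod_range_succ, ← pathSign, pathStep, if_pos (even_two_mul _), h0, hk]
      simp only [gadgetEnds, Sum.elim_inl, inputEnds, pathVertex, h0, h1, hk, hs, ← mul_assoc]
  · have h0 : (2 * k + 1) / 2 = k := by omega
    have h1 : (2 * k + 1 + 1) / 2 = k + 1 := by omega
    have hk : Fin.ofNat (r + 1) k = (⟨k, by omega⟩ : Fin r).castSucc :=
      Fin.ext (Nat.mod_eq_of_lt (by omega))
    have hk' : Fin.ofNat (r + 1) (k + 1) = (⟨k, by omega⟩ : Fin r).succ :=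
      Fin.ext (Nat.mod_eq_of_lt (by omega))
    refine ⟨Sum.inr (⟨k, by omega⟩, j, ε * pathSign x π w j (2 * k + 1)), ?_, ?_⟩
    · simp [edgePath, mul_units_cancel]
    · have hs : pathSign x π w j (2 * k + 1 + 1)
          = pathSign x π w j (2 * k + 1) * if k = 0 then w j else 1 := by
        rw [pathSign, Finset.prod_range_succ, ← pathSign]
        simp [pathStep]
      simp only [gadgetEnds, Sum.elim_inr, matchingEnds, pathVertex, h0, h1, hk, hk', hs,
        ← mul_assoc]

lemma card_gadgetEdge : Fintype.card (GadgetEdge r m) = 2 * m * (2 * r + 1) := by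
  simp only [GadgetEdge, Fintype.card_sum, Fintype.card_prod, Fintype.card_fin,
    Fintype.card_units_int]
  ring

/-- If `w` agrees with the hidden parities, then every path is a closed walk of odd length, so each
of the `2 * m` paths has an edge that is not cut. -/
lemma card_cut_le (hr : 1 ≤ r) (f : GadgetVertex r m → ℤˣ) :
    (Finset.univ.filter fun e => f (gadgetEnds x π (hiddenParity π x) e).1
      ≠ f (gadgetEnds x π (hiddenParity π x) e).2).card ≤ 2 * m * (2 * r) := by
  set w := hiddenParity π x with hw
  have hsurj : Set.SurjOn (edgePath x π w) (Finset.univ.filter fun e =>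
      ¬ f (gadgetEnds x π w e).1 ≠ f (gadgetEnds x π w e).2)
      (Finset.univ : Finset (Fin m × ℤˣ)) := by
    rintro ⟨j, ε⟩ -
    by_contra hcon
    have halt : ∀ L ≤ 2 * r + 1, f (pathVertex x π w j ε L)
        = (-1) ^ L * f (pathVertex x π w j ε 0) := by
      intro L hL
      induction L with
      | zero => simp
      | succ L ih =>
        obtain ⟨e, he1, he2⟩ := exists_edge_of_path x π w j ε (by omega : L ≤ 2 * r)
        have hcut : f (gadgetEnds x π w e).1 ≠ f (gadgetEnds x π w e).2 := by
          by_contra h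
          exact hcon ⟨e, by simpa using h, he1⟩
        rw [he2] at hcut
        simp only at hcut
        rw [pow_succ, mul_neg_one, neg_mul, ← ih (by omega)]
        exact Int.units_ne_iff_eq_neg.mp hcut.symm
    have hlast := halt (2 * r + 1) le_rfl
    rw [pathVertex, pathVertex, gadgetVertex_last, gadgetVertex_zero, pathSign_last x π w hr, hw,
      Int.units_mul_self, pow_succ, pow_mul] at hlast
    simp only [pathSign, Finset.range_zero, Finset.prod_empty, neg_one_sq, one_pow, one_mul,
      mul_one, neg_mul] at hlast
    exact units_ne_neg_self _ hlast
  have h1 := Finset.card_le_card_of_surjOn _ hsurj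
  have h2 := Finset.card_filter_add_card_filter_not (s := (Finset.univ : Finset (GadgetEdge r m)))
    (fun e => f (gadgetEnds x π w e).1 ≠ f (gadgetEnds x π w e).2)
  rw [Finset.card_univ, card_gadgetEdge] at h2
  simp only [Finset.card_univ, Fintype.card_prod, Fintype.card_fin, Fintype.card_units_int] at h1
  have h3 : 2 * m * (2 * r + 1) = 2 * m * (2 * r) + m * 2 := by ring
  omega

/-- If `w` is opposite to the hidden parities, then all paths run from one hub to the other,
and colouring them alternately cuts all edges. -/
lemma exists_cut_all (hr : 1 ≤ r) : ∃ f : GadgetVertex r m → ℤˣ,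
    ∀ e, f (gadgetEnds x π (-hiddenParity π x) e).1
      ≠ f (gadgetEnds x π (-hiddenParity π x) e).2 := by
  set w := -hiddenParity π x with hw
  let f : GadgetVertex r m → ℤˣ := fun y => match y with
    | Sum.inl ε => ε
    | Sum.inr (k, i, ε) => (-1) ^ (k + 1 : ℕ) *
        (ε * pathSign x π w ((π (Fin.ofNat (r + 1) ((k + 1) / 2))).symm i) (k + 1))
  have hf : ∀ j ε, ∀ L ≤ 2 * r + 1, f (pathVertex x π w j ε L) = (-1) ^ L * ε := by
    intro j ε L hL
    rcases Nat.eq_zero_or_pos L with rfl | hpos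
    · simp [pathVertex, gadgetVertex_zero, f, pathSign]
    rcases hL.eq_or_lt with rfl | hlt
    · rw [pathVertex, gadgetVertex_last, pathSign_last x π w hr, hw]
      simp [f, pow_succ, Int.units_mul_self]
    · have h : 1 ≤ L ∧ L - 1 < 2 * r := ⟨hpos, by omega⟩
      rw [pathVertex, gadgetVertex, dif_pos h]
      simp only [f, Nat.sub_add_cancel hpos, Equiv.symm_apply_apply, mul_units_cancel]
  refine ⟨f, fun e => ?_⟩
  obtain ⟨L, hL, he⟩ := gadgetEnds_eq_pathVertex x π w e
  rw [he, hf _ _ L (by omega), hf _ _ (L + 1) (by omega), pow_succ, mul_neg_one, neg_mul]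
  exact units_ne_neg_self _

end Gadget

/-! ### The hard streams -/

section Streams

variable {n r m : ℕ} (φ : GadgetVertex r m ↪ Fin n)

/-- The first part of the stream, which depends on `x` only. The edges come in an arbitrary order
that does not depend on `x`. -/
noncomputable def inputStream (x : Fin (r + 1) × Fin m → ℤˣ) : List (Sym2 (Fin n)) :=
  Finset.univ.toList.map fun e => s(φ (inputEnds x e).1, φ (inputEnds x e).2)

/-- The second part of the stream, which depends on `π` and `w` only. -/
noncomputable def matchingStream (π : Fin (r + 1) → Equiv.Perm (Fin m)) (w : Fin m → ℤˣ) :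
    List (Sym2 (Fin n)) :=
  Finset.univ.toList.map fun e => s(φ (matchingEnds π w e).1, φ (matchingEnds π w e).2)

variable (x : Fin (r + 1) × Fin m → ℤˣ) (π : Fin (r + 1) → Equiv.Perm (Fin m)) (w : Fin m → ℤˣ)

/-- The hard graph, on the vertex set `Fin n`. -/
def gadgetGraph : SimpleGraph (Fin n) :=
  SimpleGraph.fromEdgeSet
    (Set.range fun e => s(φ (gadgetEnds x π w e).1, φ (gadgetEnds x π w e).2))

lemma embedded_edge_injective (hr : 1 ≤ r) :
    Function.Injective fun e => s(φ (gadgetEnds x π w e).1, φ (gadgetEnds x π w e).2) :=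
  fun _ _ h => gadgetEnds_injective x π w hr (Sym2.map.injective φ.injective h)

lemma mem_edgeSet_gadgetGraph (hr : 1 ≤ r) (e : Sym2 (Fin n)) :
    e ∈ (gadgetGraph φ x π w).edgeSet ↔
      e ∈ Set.range fun e => s(φ (gadgetEnds x π w e).1, φ (gadgetEnds x π w e).2) := by
  rw [gadgetGraph, SimpleGraph.edgeSet_fromEdgeSet, Set.mem_sdiff]
  refine and_iff_left_of_imp ?_
  rintro ⟨e, rfl⟩ hdiag
  exact gadgetEnds_ne x π w hr e (φ.injective (Sym2.mk_isDiag_iff.mp hdiag))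

lemma isEdgeStream_gadget (hr : 1 ≤ r) :
    IsEdgeStream (gadgetGraph φ x π w) (inputStream φ x ++ matchingStream φ π w) := by
  have hlist : inputStream φ x ++ matchingStream φ π w
      = (Finset.univ.toList.map Sum.inl ++ Finset.univ.toList.map Sum.inr : List
          (GadgetEdge r m)).map
        fun e => s(φ (gadgetEnds x π w e).1, φ (gadgetEnds x π w e).2) := by
    rw [List.map_append, List.map_map, List.map_map]
    rfl
  rw [hlist]
  refine ⟨List.Nodup.map (embedded_edge_injective φ x π w hr) ?_, fun e => ?_⟩
  · refine List.Nodup.append ((Finset.nodup_toList _).map Sum.inl_injective)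
      ((Finset.nodup_toList _).map Sum.inr_injective) ?_
    intro e h1 h2
    simp only [List.mem_map] at h1 h2
    obtain ⟨_, _, rfl⟩ := h1
    obtain ⟨_, _, h⟩ := h2
    exact Sum.inr_ne_inl h
  · rw [mem_edgeSet_gadgetGraph φ x π w hr, List.mem_map]
    refine exists_congr fun e' => and_iff_right ?_
    rcases e' with e' | e' <;> simp

lemma maxCut_gadget_le (hr : 1 ≤ r) :
    maxCut (gadgetGraph φ x π (hiddenParity π x)) ≤ 2 * m * (2 * r) :=
  maxCut_le (fun e => φ (gadgetEnds x π (hiddenParity π x) e).1)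
    (fun e => φ (gadgetEnds x π (hiddenParity π x) e).2) _
    (embedded_edge_injective φ x π _ hr) (mem_edgeSet_gadgetGraph φ x π _ hr) _
    fun f => card_cut_le x π hr (f ∘ φ)

lemma le_maxCut_gadget (hr : 1 ≤ r) :
    2 * m * (2 * r + 1) ≤ maxCut (gadgetGraph φ x π (-hiddenParity π x)) := by
  obtain ⟨f, hf⟩ := exists_cut_all x π hr
  have h := card_cut_le_maxCut (fun e => φ (gadgetEnds x π (-hiddenParity π x) e).1)
    (fun e => φ (gadgetEnds x π (-hiddenParity π x) e).2) _
    (embedded_edge_injective φ x π _ hr) (mem_edgeSet_gadgetGraph φ x π _ hr)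
    (Function.extend φ f 1)
  simp only [φ.injective.extend_apply] at h
  rwa [Finset.filter_true_of_mem fun e _ => hf e, Finset.card_univ, card_gadgetEdge] at h

end Streams

/-! ### Streaming algorithms as protocols -/

namespace StreamAlg

variable {n s : ℕ} {Ω : Type*} [MeasurableSpace Ω] (A : StreamAlg n s Ω)

lemma runFrom_append (ω : Ω) (i : ℕ) (a : Memory s) (l₁ l₂ : List (Sym2 (Fin n))) :
    A.runFrom ω i a (l₁ ++ l₂) = A.runFrom ω (i + l₁.length) (A.runFrom ω i a l₁) l₂ := by
  induction l₁ generalizing i a with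
  | nil => rfl
  | cons e l₁ ih =>
    rw [List.cons_append, runFrom, ih, runFrom, List.length_cons, add_assoc, add_comm 1]

lemma measurable_comp_memory {β : Type*} [MeasurableSpace β] {f : Ω → Memory s → β}
    (hf : ∀ a, Measurable fun ω => f ω a) {a : Ω → Memory s} (ha : Measurable a) :
    Measurable fun ω => f ω (a ω) := by
  have h : Measurable fun p : Ω × Memory s => f p.1 p.2 := measurable_from_prod_countable_left hf
  exact h.comp (measurable_id.prodMk ha)

lemma measurable_runFrom (l : List (Sym2 (Fin n))) (i : ℕ) {a : Ω → Memory s}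
    (ha : Measurable a) : Measurable fun ω => A.runFrom ω i (a ω) l := by
  induction l generalizing i a with
  | nil => exact ha
  | cons e l ih => exact ih (i + 1) (measurable_comp_memory (fun b => A.measurable_step i b e) ha)

lemma measurable_result (l : List (Sym2 (Fin n))) : Measurable fun ω => A.result ω l :=
  measurable_comp_memory (A.measurable_output l.length) (A.measurable_runFrom l 0 A.measurable_init)

end StreamAlg

/-- If every event of a finite family has probability at least `p`, then some outcome lies in a
fraction at least `p` of them. -/
lemma exists_outcome {Ω I : Type*} [MeasurableSpace Ω] [Fintype I] (μ : Measure Ω)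
    [IsProbabilityMeasure μ] (B : I → Set Ω) (hB : ∀ i, MeasurableSet (B i)) (p : ℝ)
    (h : ∀ i, p ≤ μ.real (B i)) :
    ∃ ω, p * Fintype.card I ≤ ∑ i, (B i).indicator (fun _ => (1 : ℝ)) ω := by
  have hint : ∀ i, Integrable ((B i).indicator fun _ => (1 : ℝ)) μ := fun i =>
    (integrable_const 1).indicator (hB i)
  obtain ⟨ω, hω⟩ := exists_integral_le (μ := μ) (integrable_finsetSum Finset.univ fun i _ => hint i)
  refine ⟨ω, le_trans ?_ hω⟩
  rw [integral_finsetSum _ fun i _ => hint i]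
  simp_rw [integral_indicator_const (1 : ℝ) (hB _)]
  calc p * Fintype.card I = ∑ _i : I, p := by simp [mul_comm]
    _ ≤ _ := Finset.sum_le_sum fun i _ => by simpa using h i

/-- The reduction: a streaming algorithm for maxcut whose memory fits into `S` bits would be a
protocol for the hidden matching problem, the message being the memory between the two parts of the
stream. -/
theorem lt_memory_of_approximates {n s r m S : ℕ} {Ω : Type*} [MeasurableSpace Ω] (μ : Measure Ω)
    [IsProbabilityMeasure μ] (A : StreamAlg n s Ω) (hr : 1 ≤ r)
    (hA : A.Approximates μ (1 + 1 / (2 * ((r + 1 : ℕ) : ℝ))) (1 / 4)) (hn : 2 + 4 * r * m ≤ n)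
    (hm : Even m) (hm9 : 9 ≤ m) (hS : 2 * (r + 1) ≤ S) (hSm : (24 * S) ^ (r + 1) ≤ m ^ r) :
    S < s := by
  by_contra hsS
  set γ : ℝ := 1 + 1 / (2 * ((r + 1 : ℕ) : ℝ)) with hγ
  have hγpos : 0 < γ := by positivity
  obtain ⟨φ⟩ : Nonempty (GadgetVertex r m ↪ Fin n) := by
    refine Function.Embedding.nonempty_of_card_le ?_
    simp only [GadgetVertex, Fintype.card_sum, Fintype.card_prod, Fintype.card_fin,
      Fintype.card_units_int]
    calc 2 + 2 * r * (m * 2) = 2 + 4 * r * m := by ring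
      _ ≤ n := hn
  -- the value `OPT / γ` in the bipartite case; it exceeds `OPT` in the other case
  set θ : ℝ := (2 * m * (2 * r + 1) : ℕ) / γ with hθ
  have hgap : ((2 * m * (2 * r) : ℕ) : ℝ) < θ := by
    rw [hθ, lt_div_iff₀ hγpos, hγ]
    have hmpos : (0 : ℝ) < m := by exact_mod_cast (by omega : 0 < m)
    have hrpos : (0 : ℝ) ≤ r := Nat.cast_nonneg r
    push_cast
    field_simp
    nlinarith
  set G : (Fin (r + 1) → Equiv.Perm (Fin m)) × (Fin (r + 1) × Fin m → ℤˣ) → (Fin m → ℤˣ) →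
    SimpleGraph (Fin n) := fun p w => gadgetGraph φ p.2 p.1 w
  set l : (Fin (r + 1) → Equiv.Perm (Fin m)) × (Fin (r + 1) × Fin m → ℤˣ) → (Fin m → ℤˣ) →
    List (Sym2 (Fin n)) := fun p w => inputStream φ p.2 ++ matchingStream φ p.1 w
  -- the instances: the sign tells which of the two cases `w = ± hiddenParity π x` holds
  set W : ((Fin (r + 1) → Equiv.Perm (Fin m)) × (Fin (r + 1) × Fin m → ℤˣ)) × Bool →
    (Fin m → ℤˣ) := fun i => if i.2 then hiddenParity i.1.1 i.1.2 else -hiddenParity i.1.1 i.1.2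
    with hW
  set B : ((Fin (r + 1) → Equiv.Perm (Fin m)) × (Fin (r + 1) × Fin m → ℤˣ)) × Bool → Set Ω :=
    fun i => {ω | A.result ω (l i.1 (W i)) ∈
      Set.Icc ((maxCut (G i.1 (W i)) : ℝ) / γ) (maxCut (G i.1 (W i)) : ℝ)} with hBdef
  obtain ⟨ω, hω⟩ := exists_outcome μ B
    (fun i => A.measurable_result _ measurableSet_Icc) (1 - 1 / 4)
    (fun i => hA _ _ (isEdgeStream_gadget φ i.1.2 i.1.1 _ hr))
  set lenI : ℕ := (Finset.univ : Finset (Fin (r + 1) × Fin m × ℤˣ)).toList.length with hlenI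
  set lenM : ℕ := (Finset.univ : Finset (Fin r × Fin m × ℤˣ)).toList.length with hlenM
  let msg : (Fin (r + 1) × Fin m → ℤˣ) → Memory s := fun x =>
    A.runFrom ω 0 (A.init ω) (inputStream φ x)
  let D : Memory s → (Fin (r + 1) → Equiv.Perm (Fin m)) → (Fin m → ℤˣ) → ℝ := fun a π w =>
    if θ ≤ A.output (lenI + lenM) ω (A.runFrom ω lenI a (matchingStream φ π w)) then 1 / 2
    else -(1 / 2)
  have hDval : ∀ p w, D (msg p.2) p.1 w = if θ ≤ A.result ω (l p w) then 1 / 2 else -(1 / 2) := by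
    intro p w
    have h1 : (inputStream φ p.2).length = lenI := by simp only [inputStream, List.length_map, hlenI]
    have h2 : (matchingStream φ p.1 w).length = lenM := by
      simp only [matchingStream, List.length_map, hlenM]
    simp only [D, msg, l, StreamAlg.result, StreamAlg.runFrom_append, List.length_append, h1, h2,
      zero_add]
  have hpt : ∀ p : (Fin (r + 1) → Equiv.Perm (Fin m)) × (Fin (r + 1) × Fin m → ℤˣ),
      ∑ b, (B (p, b)).indicator (fun _ => (1 : ℝ)) ω - 1
        ≤ D (msg p.2) p.1 (-hiddenParity p.1 p.2) - D (msg p.2) p.1 (hiddenParity p.1 p.2) := by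
    intro p
    have hneg : (B (p, false)).indicator (fun _ => (1 : ℝ)) ω - 1 / 2
        ≤ D (msg p.2) p.1 (-hiddenParity p.1 p.2) := by
      rw [hDval]
      by_cases hmem : ω ∈ B (p, false)
      · have h1 : (maxCut (G p (-hiddenParity p.1 p.2)) : ℝ) / γ
          ≤ A.result ω (l p (-hiddenParity p.1 p.2)) := by
          simpa [hW] using hmem.1
        have h2 : θ ≤ (maxCut (G p (-hiddenParity p.1 p.2)) : ℝ) / γ :=
          div_le_div_of_nonneg_right (by exact_mod_cast le_maxCut_gadget φ p.2 p.1 hr) hγpos.le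
        rw [Set.indicator_of_mem hmem, if_pos (h2.trans h1)]
        norm_num
      · rw [Set.indicator_of_notMem hmem]
        split_ifs <;> norm_num
    have hpos : D (msg p.2) p.1 (hiddenParity p.1 p.2)
        ≤ 1 / 2 - (B (p, true)).indicator (fun _ => (1 : ℝ)) ω := by
      rw [hDval]
      by_cases hmem : ω ∈ B (p, true)
      · have h1 : A.result ω (l p (hiddenParity p.1 p.2))
          ≤ (maxCut (G p (hiddenParity p.1 p.2)) : ℝ) := by
          simpa [hW] using hmem.2
        have h2 : (maxCut (G p (hiddenParity p.1 p.2)) : ℝ) ≤ ((2 * m * (2 * r) : ℕ) : ℝ) := by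
          exact_mod_cast maxCut_gadget_le φ p.2 p.1 hr
        rw [Set.indicator_of_mem hmem, if_neg (not_le.mpr ((h1.trans h2).trans_lt hgap))]
        norm_num
      · rw [Set.indicator_of_notMem hmem]
        split_ifs <;> norm_num
    rw [Fintype.sum_bool]
    linarith
  have hlt := advantage_lt (S := S) msg D (fun a π w => by simp only [D]; split_ifs <;> norm_num)
    (by rw [Fintype.card_fin]; omega) (by rwa [Fintype.card_fin])
    (by simpa only [Fintype.card_fin, Nat.add_sub_cancel] using hSm)
    (by rwa [Fintype.card_fin]) (by rwa [Fintype.card_fin])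
    (by simpa [Memory] using Nat.pow_le_pow_right two_pos (not_lt.mp hsS))
  have hsum := Finset.sum_le_sum fun p (_ : p ∈ Finset.univ) => hpt p
  rw [Finset.sum_sub_distrib, ← Fintype.sum_prod_type', Fintype.sum_prod_type (f := fun p :
    (Fin (r + 1) → Equiv.Perm (Fin m)) × (Fin (r + 1) × Fin m → ℤˣ) =>
    D (msg p.2) p.1 (-hiddenParity p.1 p.2) - D (msg p.2) p.1 (hiddenParity p.1 p.2))] at hsum
  rw [Fintype.card_prod, Fintype.card_bool] at hω
  rw [Finset.sum_const, Finset.card_univ, nsmul_eq_mul, mul_one] at hsum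
  simp only [Fintype.card_prod] at hω hsum
  push_cast at hω hsum hlt
  linarith

end MaxCutStream

theorem theorem3 (t : ℕ) (ht : 2 ≤ t) :
    ∃ c : ℝ, 0 < c ∧ ∃ n₀ : ℕ, ∀ n : ℕ, n₀ ≤ n →
      ∀ (s : ℕ) (Ω : Type*) [MeasurableSpace Ω] (μ : Measure Ω) [IsProbabilityMeasure μ]
        (A : MaxCutStream.StreamAlg n s Ω),
        A.Approximates μ (1 + 1 / (2 * (t : ℝ))) (1 / 4) →
          c * (n : ℝ) ^ (1 - 1 / (t : ℝ)) ≤ (s : ℝ) := by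
  have ht0 : (2 : ℝ) ≤ t := by exact_mod_cast ht
  set β : ℝ := 1 - 1 / (t : ℝ) with hβ
  have hβhalf : 1 / 2 ≤ β := by
    have : 1 / (t : ℝ) ≤ 1 / 2 := one_div_le_one_div_of_le two_pos ht0
    linarith
  refine ⟨(1 / (8 * (t : ℝ))) ^ β / 24, by positivity, 8 * t * (48 * t) ^ 2, ?_⟩
  intro n hn s Ω _ μ _ A hA
  -- an even `m` of order `n / t` such that the `2 + 4 * (t - 1) * m` vertices of the hard graphs
  -- fit into `n`
  set d : ℕ := n / (8 * t) with hd
  have hdge : (48 * t) ^ 2 ≤ d := (Nat.le_div_iff_mul_le (by omega)).mpr (by rwa [mul_comm])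
  have hd1 : 8 * t * d ≤ n := Nat.mul_div_le n (8 * t)
  have hd2 : n < 8 * t * (d + 1) := Nat.lt_mul_div_succ n (by omega)
  have hd5 : 5 ≤ d := le_trans (by nlinarith) hdge
  set m : ℕ := 2 * d with hm
  have hmn : (n : ℝ) * (1 / (8 * t)) ≤ m := by
    rw [mul_one_div, div_le_iff₀ (by positivity)]
    have : n ≤ m * (8 * t) := by nlinarith
    exact_mod_cast this
  have hm1 : (1 : ℝ) ≤ m := by exact_mod_cast (by omega : 1 ≤ m)
  set S : ℕ := ⌊(m : ℝ) ^ β / 24⌋₊ with hS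
  have hSt : 2 * t ≤ S := by
    refine Nat.le_floor ?_
    rw [le_div_iff₀ (by norm_num)]
    have h1 : ((48 * t : ℕ) : ℝ) ≤ (m : ℝ) ^ (1 / 2 : ℝ) := by
      rw [← Real.sqrt_eq_rpow]
      refine Real.le_sqrt_of_sq_le ?_
      exact_mod_cast hdge.trans (by omega)
    have h2 := h1.trans (Real.rpow_le_rpow_of_exponent_le hm1 hβhalf)
    push_cast at h2 ⊢
    linarith
  have hSm : (24 * S) ^ t ≤ m ^ (t - 1) := by
    have h1 : (24 * S : ℝ) ≤ (m : ℝ) ^ β := by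
      have := Nat.floor_le (by positivity : 0 ≤ (m : ℝ) ^ β / 24)
      rw [← hS] at this
      linarith
    have h2 : (24 * S : ℝ) ^ t ≤ (m : ℝ) ^ (t - 1) := by
      refine (pow_le_pow_left₀ (by positivity) h1 t).trans (le_of_eq ?_)
      rw [← Real.rpow_natCast, ← Real.rpow_mul (by positivity), ← Real.rpow_natCast]
      congr 1
      rw [hβ, Nat.cast_sub (by omega)]
      push_cast
      field_simp
    exact_mod_cast h2
  obtain ⟨r, rfl⟩ : ∃ r, t = r + 1 := ⟨t - 1, by omega⟩
  have hlt : S < s := MaxCutStream.lt_memory_of_approximates μ A (by omega) hA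
    (m := m) (by nlinarith) (even_two_mul d) (by omega) hSt (by simpa using hSm)
  have hfl : (m : ℝ) ^ β / 24 < S + 1 := Nat.lt_floor_add_one _
  have hs : (S : ℝ) + 1 ≤ s := by exact_mod_cast hlt
  calc (1 / (8 * ((r + 1 : ℕ) : ℝ))) ^ β / 24 * (n : ℝ) ^ β
      = ((n : ℝ) * (1 / (8 * ((r + 1 : ℕ) : ℝ)))) ^ β / 24 := by
        rw [Real.mul_rpow (by positivity) (by positivity)]
        ring
    _ ≤ (m : ℝ) ^ β / 24 := by
        refine div_le_div_of_nonneg_right ?_ (by norm_num)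
        exact Real.rpow_le_rpow (by positivity) hmn (by linarith)
    _ ≤ s := by linarith
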